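/- Conventions. For integers $a,b,c$ the form $ax^2+bxy+cy^2$ has discriminant $b^2-4ac$; only positive definite forms ($a>0$, negative discriminant) are considered, and forms are equivalent if they are related by a matrix in $SL(2,\mathbb Z)$. The symbol $(a,b,c)$ denotes the form and also its class, and $(a,b,c,q)=\sum_{x,y\in\mathbb Z}q^{ax^2+bxy+cy^2}$ is its theta series, as a formal power series in $q$. For a power series, $P_{m,r}\sum_{n\ge 0}a(n)q^n=\sum_{n\ge 0,\ n\equiv r \,(\mathrm{mod}\, m)}a(n)q^n$. Two primitive forms of discriminant $D$ are in the same genus if they are equivalent by a matrix in $SL(2,\mathbb Q)$ whose entries have denominators coprime to $2D$; a genus of discriminant $D$ is regarded as a set of classes of primitive forms of discriminant $D$. Theorem. Let $p$ be a prime, let $(a,b,c)$ be a primitive form of discriminant $\Delta<0$, and let $G$ be a genus of discriminant $\Delta p^2$. Let $\Psi_{G,p}(a,b,c)$ be the set of those classes in $G$ that contain a primitive form belonging to $$\{(a,bp,cp^2)\}\cup\{(ap^2,\,pb+2ahp,\,ah^2+bh+c):0\le h<p\}$$ (each class is counted once), and suppose that $\Psi_{G,p}(a,b,c)$ is nonempty.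 Let $r$ be any integer that is coprime to $\Delta p^2$ and represented by some class in $\Psi_{G,p}(a,b,c)$. Put $w=3,2,1$ according as $\Delta=-3$, $\Delta=-4$, $\Delta<-4$. If $p$ is odd, then $$w\sum_{(A,B,C)\in\Psi_{G,p}(a,b,c)}(A,B,C,q)=w\,|\Psi_{G,p}(a,b,c)|\,(a,b,c,q^{p^2})+\sum_{i=1}^{p-1}\tfrac12\left(\left(\tfrac{ri}{p}\right)+1\right)P_{p,i}(a,b,c,q),$$ where $\left(\tfrac{\cdot}{p}\right)$ is the Legendre symbol. If $p=2$, then $$w\sum_{(A,B,C)\in\Psi_{G,2}(a,b,c)}(A,B,C,q)=w\,|\Psi_{G,2}(a,b,c)|\,(a,b,c,q^{4})+P_{2^{t+1},r}(a,b,c,q),$$ where $t=2$ if $\Delta\equiv 0 \pmod{16}$, and otherwise $t=0$ or $t=1$ according to whether $\Delta$ is odd or even. -/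

import Mathlib

open scoped Classical

/-- The binary quadratic form `a x² + b x y + c y²` with coefficients in `R`. -/
@[ext]
structure BQForm (R : Type) where
  a : R
  b : R
  c : R

namespace BQForm

/-- The value `a x² + b x y + c y²`. -/
def eval {R : Type} [CommRing R] (f : BQForm R) (x y : R) : R :=
  f.a * x ^ 2 + f.b * x * y + f.c * y ^ 2

/-- The discriminant `b² - 4ac`. -/
def disc {R : Type} [CommRing R] (f : BQForm R) : R := f.b ^ 2 - 4 * f.a * f.c

/-- The substitution `(x, y) ↦ M (x, y)`, as a form; see `eval_act`. -/
def act {R : Type} [CommRing R] (f : BQForm R) (M : Matrix (Fin 2) (Fin 2) R) : BQForm R where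
  a := f.eval (M 0 0) (M 1 0)
  b := 2 * f.a * M 0 0 * M 0 1 + f.b * (M 0 0 * M 1 1 + M 0 1 * M 1 0) + 2 * f.c * M 1 0 * M 1 1
  c := f.eval (M 0 1) (M 1 1)

theorem eval_act {R : Type} [CommRing R] (f : BQForm R) (M : Matrix (Fin 2) (Fin 2) R) (x y : R) :
    (f.act M).eval x y = f.eval (M 0 0 * x + M 0 1 * y) (M 1 0 * x + M 1 1 * y) := by
  simp only [act, eval]; ring

theorem act_one {R : Type} [CommRing R] (f : BQForm R) : f.act 1 = f := by
  ext <;> simp [act, eval]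

theorem act_mul {R : Type} [CommRing R] (f : BQForm R) (M N : Matrix (Fin 2) (Fin 2) R) :
    f.act (M * N) = (f.act M).act N := by
  ext <;> simp only [act, eval, Matrix.mul_apply, Fin.sum_univ_two] <;> ring

/-- The coefficients have no common factor. -/
def IsPrimitive (f : BQForm ℤ) : Prop := Int.gcd (Int.gcd f.a f.b) f.c = 1

/-- Positive definite: negative discriminant and positive leading coefficient. -/
def IsPosDef (f : BQForm ℤ) : Prop := 0 < f.a ∧ f.disc < 0

/-- An integral form regarded as a rational one. -/
def toRat (f : BQForm ℤ) : BQForm ℚ := ⟨f.a, f.b, f.c⟩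

/-- Proper equivalence, i.e. equivalence by a matrix in `SL(2, ℤ)`. -/
instance setoid : Setoid (BQForm ℤ) where
  r f g := ∃ M : Matrix.SpecialLinearGroup (Fin 2) ℤ, g = f.act M.1
  iseqv :=
    { refl := fun f => ⟨1, by simp [act_one]⟩
      symm := by
        rintro f g ⟨M, rfl⟩
        refine ⟨M⁻¹, ?_⟩
        rw [← act_mul, ← Matrix.SpecialLinearGroup.coe_mul, mul_inv_cancel]
        simp [act_one]
      trans := by
        rintro f g h ⟨M, rfl⟩ ⟨N, rfl⟩
        exact ⟨M * N, by rw [← act_mul, Matrix.SpecialLinearGroup.coe_mul]⟩ }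

/-- The total number of representations `f(x, y) = n` with `(x, y) ∈ ℤ²`
(a finite number when `f` is positive definite). -/
noncomputable def repCount (f : BQForm ℤ) (n : ℕ) : ℕ :=
  {v : ℤ × ℤ | f.eval v.1 v.2 = n}.ncard

/-- The theta series `∑ q^{f(x, y)}` as a formal power series in `q`. -/
noncomputable def theta (f : BQForm ℤ) : PowerSeries ℚ :=
  PowerSeries.mk fun n => (f.repCount n : ℚ)

theorem repCount_act (f : BQForm ℤ) (M : Matrix.SpecialLinearGroup (Fin 2) ℤ) (n : ℕ) :
    (f.act M.1).repCount n = f.repCount n := by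
  have hd : M.1 0 0 * M.1 1 1 - M.1 0 1 * M.1 1 0 = 1 := by
    rw [← Matrix.det_fin_two]; exact M.2
  refine Set.ncard_congr
    (fun v _ => (M.1 0 0 * v.1 + M.1 0 1 * v.2, M.1 1 0 * v.1 + M.1 1 1 * v.2)) ?_ ?_ ?_
  · intro v hv
    simpa [eval_act] using hv
  · rintro ⟨x, y⟩ ⟨x', y'⟩ _ _ h
    simp only [Prod.mk.injEq] at h ⊢
    obtain ⟨h1, h2⟩ := h
    constructor
    · linear_combination M.1 1 1 * h1 - M.1 0 1 * h2 - (x - x') * hd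
    · linear_combination M.1 0 0 * h2 - M.1 1 0 * h1 - (y - y') * hd
  · rintro ⟨x, y⟩ h
    have e1 : M.1 0 0 * (M.1 1 1 * x - M.1 0 1 * y) + M.1 0 1 * (M.1 0 0 * y - M.1 1 0 * x) = x := by
      linear_combination x * hd
    have e2 : M.1 1 0 * (M.1 1 1 * x - M.1 0 1 * y) + M.1 1 1 * (M.1 0 0 * y - M.1 1 0 * x) = y := by
      linear_combination y * hd
    refine ⟨(M.1 1 1 * x - M.1 0 1 * y, M.1 0 0 * y - M.1 1 0 * x), ?_, ?_⟩
    · simp only [Set.mem_ofPred_eq, eval_act, e1, e2] at h ⊢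
      exact h
    · simp only [e1, e2]

/-- Two forms of discriminant `D` are in the same genus when they are equivalent over `ℚ` by a
matrix in `SL(2, ℚ)` whose entries have denominators coprime to `2D`. -/
def SameGenus (D : ℤ) (f g : BQForm ℤ) : Prop :=
  ∃ M : Matrix.SpecialLinearGroup (Fin 2) ℚ,
    (∀ i j, IsCoprime ((M.1 i j).den : ℤ) (2 * D)) ∧ g.toRat = f.toRat.act M.1

end BQForm

/-- Classes of integral binary quadratic forms under `SL(2, ℤ)`. -/
abbrev FormClass : Type := Quotient BQForm.setoid

namespace FormClass

/-- The theta series of a class, i.e. that of any form in it. -/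
noncomputable def theta : FormClass → PowerSeries ℚ :=
  Quotient.lift BQForm.theta (by
    rintro f g ⟨M, rfl⟩
    ext n
    simp [BQForm.theta, BQForm.repCount_act])

/-- The class represents the integer `r`. -/
def Represents (C : FormClass) (r : ℤ) : Prop :=
  ∃ f : BQForm ℤ, (⟦f⟧ : FormClass) = C ∧ ∃ x y : ℤ, f.eval x y = r

end FormClass

/-- `G` is a genus of discriminant `D`: the set of all classes of primitive positive definite forms
of discriminant `D` lying in the same genus as a fixed such form. -/
def IsGenus (D : ℤ) (G : Set FormClass) : Prop :=
  ∃ f : BQForm ℤ, f.IsPrimitive ∧ f.IsPosDef ∧ f.disc = D ∧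
    G = {C | ∃ g : BQForm ℤ, g.IsPrimitive ∧ g.IsPosDef ∧ g.disc = D ∧
      BQForm.SameGenus D f g ∧ (⟦g⟧ : FormClass) = C}

/-- The forms `(a, bp, cp²)` and `(ap², pb + 2ahp, ah² + bh + c)` for `0 ≤ h < p`. -/
noncomputable def buellForms (p : ℕ) (f : BQForm ℤ) : Finset (BQForm ℤ) :=
  insert ⟨f.a, f.b * p, f.c * p ^ 2⟩
    ((Finset.range p).image fun h : ℕ =>
      ⟨f.a * p ^ 2, p * f.b + 2 * f.a * h * p, f.a * h ^ 2 + f.b * h + f.c⟩)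

/-- The set `Ψ_{G,p}(f)` of those classes in `G` which contain a primitive form among
`buellForms p f` (each class is counted once). -/
noncomputable def buellPsi (G : Set FormClass) (p : ℕ) (f : BQForm ℤ) : Finset FormClass :=
  (((buellForms p f).filter fun g => g.IsPrimitive).image fun g => (⟦g⟧ : FormClass)).filter
    fun C => C ∈ G

/-- The projection `P_{m,r}`: keep the terms whose exponent is congruent to `r` modulo `m`. -/
noncomputable def powerSeriesProj (m : ℕ) (r : ℤ) (φ : PowerSeries ℚ) : PowerSeries ℚ :=
  PowerSeries.mk fun n => if (n : ℤ) ≡ r [ZMOD (m : ℤ)] then PowerSeries.coeff n φ else 0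

/-- `w = 3, 2, 1` for `Δ = -3`, `Δ = -4`, `Δ < -4` respectively. -/
def unitWeight (Δ : ℤ) : ℕ := if Δ = -3 then 3 else if Δ = -4 then 2 else 1

/-- `t = 2` if `16 ∣ Δ`; otherwise `t = 1` or `t = 0` according to whether `Δ` is even or odd. -/
noncomputable def twoExponent (Δ : ℤ) : ℕ := if (16 : ℤ) ∣ Δ then 2 else if Even Δ then 1 else 0

/-!
The forms among which `Ψ` is selected are the restrictions of `f` to the `p + 1` sublattices of index
`p` in `ℤ²`, that is, to the lines `L` of `𝔽_p²`. The identity is a double count of the pairs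
`v ∈ L` with `f(v) = n`, over the lines whose restriction is primitive with class in `G`.

Each class in `Ψ` comes from exactly `w` of these lines (`BQForm.card_restrict_equiv`): an equivalence
between two primitive restrictions is induced by an automorph of `f`, and the automorphs modulo `±1`
are the units modulo `±1` of the order of discriminant `Δ`, which act freely on non-isotropic lines.
Hence the double count is the `n`-th coefficient of the left-hand side
(`BQForm.sum_genusLines`, `BQForm.sum_repCount_genusLines`). A vector in `pℤ²` lies on all
`w |Ψ|` lines, which gives the term with the expanded theta series. Any other vector `v` lies on one
line, and what remains is to decide when its restriction is primitive and in `G`.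

The restriction to a line is primitive when `f` does not vanish on it modulo `p`. Two such
restrictions are in the same genus exactly when values prime to `p` on the two lines agree up to
squares modulo `p` for `p` odd, and modulo `2 ^ (t + 1)` for `p = 2`. This is necessary because forms
of one genus represent the same integers up to squares prime to `2Δp²`, and `f` is constant in the
relevant sense on one line (`BQForm.OnLine.exists_eval_eq`, `BQForm.eval_modEq_of_onLine`). It is
sufficient because a rational reflection of `f`, in a vector chosen by congruences, carries a vector
of one line into the other (`BQForm.sameGenus_of_isSquare`, `BQForm.sameGenus_of_modEq`), and two
forms of the same discriminant representing a common value prime to `2Δp²` are in the same genus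
(`BQForm.sameGenus_of_eval_eq`).
-/

namespace BQForm

/-! ### Values of primitive forms -/

/-- The symmetric bilinear form `f(v + w) - f(v) - f(w)` attached to `f`. -/
def polar (f : BQForm ℤ) (v w : ℤ × ℤ) : ℤ :=
  2 * f.a * v.1 * w.1 + f.b * (v.1 * w.2 + v.2 * w.1) + 2 * f.c * v.2 * w.2

/-- The product of an integral matrix with a column vector, vectors being written as pairs. -/
def mulPair (M : Matrix (Fin 2) (Fin 2) ℤ) (w : ℤ × ℤ) : ℤ × ℤ :=
  (M 0 0 * w.1 + M 0 1 * w.2, M 1 0 * w.1 + M 1 1 * w.2)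

theorem eval_mulPair (f : BQForm ℤ) (M : Matrix (Fin 2) (Fin 2) ℤ) (w : ℤ × ℤ) :
    f.eval (mulPair M w).1 (mulPair M w).2 = (f.act M).eval w.1 w.2 :=
  (eval_act f M w.1 w.2).symm

theorem mulPair_mul (M N : Matrix (Fin 2) (Fin 2) ℤ) (w : ℤ × ℤ) :
    mulPair (M * N) w = mulPair M (mulPair N w) := by
  ext <;> simp only [mulPair, Matrix.mul_apply, Fin.sum_univ_two] <;> ring

theorem mulPair_injective {M : Matrix (Fin 2) (Fin 2) ℤ} (hM : M.det ≠ 0) :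
    Function.Injective (mulPair M) := by
  rintro ⟨x, y⟩ ⟨x', y'⟩ h
  simp only [mulPair, Prod.mk.injEq] at h
  rw [Matrix.det_fin_two] at hM
  ext
  · apply mul_left_cancel₀ hM
    linear_combination M 1 1 * h.1 - M 0 1 * h.2
  · apply mul_left_cancel₀ hM
    linear_combination M 0 0 * h.2 - M 1 0 * h.1

theorem disc_act {R : Type} [CommRing R] (f : BQForm R) (M : Matrix (Fin 2) (Fin 2) R) :
    (f.act M).disc = f.disc * M.det ^ 2 := by
  simp only [disc, act, eval, Matrix.det_fin_two]; ring

theorem act_smul_one {R : Type} [CommRing R] (f : BQForm R) (k : R) :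
    f.act (k • (1 : Matrix (Fin 2) (Fin 2) R)) = ⟨k ^ 2 * f.a, k ^ 2 * f.b, k ^ 2 * f.c⟩ := by
  ext <;> simp [act, eval] <;> ring

theorem dvd_act {f : BQForm ℤ} {d : ℤ} (ha : d ∣ f.a) (hb : d ∣ f.b) (hc : d ∣ f.c)
    (M : Matrix (Fin 2) (Fin 2) ℤ) :
    d ∣ (f.act M).a ∧ d ∣ (f.act M).b ∧ d ∣ (f.act M).c := by
  obtain ⟨a, ha⟩ := ha
  obtain ⟨b, hb⟩ := hb
  obtain ⟨c, hc⟩ := hc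
  simp only [act, eval, ha, hb, hc]
  exact ⟨⟨a * M 0 0 ^ 2 + b * M 0 0 * M 1 0 + c * M 1 0 ^ 2, by ring⟩,
    ⟨2 * a * M 0 0 * M 0 1 + b * (M 0 0 * M 1 1 + M 0 1 * M 1 0) + 2 * c * M 1 0 * M 1 1, by ring⟩,
    ⟨a * M 0 1 ^ 2 + b * M 0 1 * M 1 1 + c * M 1 1 ^ 2, by ring⟩⟩

theorem isPrimitive_iff (f : BQForm ℤ) : f.IsPrimitive ↔
    ∀ q : ℕ, q.Prime → ¬ ((q : ℤ) ∣ f.a ∧ (q : ℤ) ∣ f.b ∧ (q : ℤ) ∣ f.c) := by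
  unfold IsPrimitive
  rw [Nat.eq_one_iff_not_exists_prime_dvd]
  refine forall₂_congr fun q _ => not_congr ?_
  rw [← Int.natCast_dvd_natCast, Int.dvd_coe_gcd_iff, Int.dvd_coe_gcd_iff, and_assoc]

theorem IsPrimitive.exists_bezout {f : BQForm ℤ} (hf : f.IsPrimitive) :
    ∃ α β γ : ℤ, α * f.a + β * f.b + γ * f.c = 1 := by
  unfold IsPrimitive at hf
  have h1 := Int.gcd_eq_gcd_ab (Int.gcd f.a f.b) f.c
  have h2 := Int.gcd_eq_gcd_ab f.a f.b
  rw [hf] at h1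
  set X := Int.gcdA (Int.gcd f.a f.b) f.c
  exact ⟨Int.gcdA f.a f.b * X, Int.gcdB f.a f.b * X, Int.gcdB (Int.gcd f.a f.b) f.c, by
    push_cast at h1
    linear_combination X * (-h2) - h1⟩

theorem IsPrimitive.act {f : BQForm ℤ} (hf : f.IsPrimitive)
    (M : Matrix.SpecialLinearGroup (Fin 2) ℤ) : (f.act M.1).IsPrimitive := by
  rw [isPrimitive_iff] at hf ⊢
  intro q hq ⟨ha, hb, hc⟩
  have h := dvd_act ha hb hc (M⁻¹).1
  rw [← act_mul, ← Matrix.SpecialLinearGroup.coe_mul, mul_inv_cancel] at h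
  simp only [Matrix.SpecialLinearGroup.coe_one, act_one] at h
  exact hf q hq h

theorem eval_modEq (f : BQForm ℤ) {m x y x' y' : ℤ} (hx : x ≡ x' [ZMOD m]) (hy : y ≡ y' [ZMOD m]) :
    f.eval x y ≡ f.eval x' y' [ZMOD m] := by
  unfold eval
  gcongr

theorem polar_modEq (f : BQForm ℤ) (v : ℤ × ℤ) {m : ℤ} {w w' : ℤ × ℤ} (hx : w.1 ≡ w'.1 [ZMOD m])
    (hy : w.2 ≡ w'.2 [ZMOD m]) : f.polar v w ≡ f.polar v w' [ZMOD m] := by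
  unfold polar
  gcongr

theorem isCoprime_of_modEq {a b m : ℤ} (h : a ≡ b [ZMOD m]) (hb : IsCoprime b m) : IsCoprime a m := by
  obtain ⟨k, hk⟩ := h.dvd
  rw [show a = b + m * (-k) by linear_combination -hk]
  exact hb.add_mul_left_left _

theorem exists_modEq_modEq {m n : ℤ} (h : IsCoprime m n) (a b : ℤ) :
    ∃ x : ℤ, x ≡ a [ZMOD m] ∧ x ≡ b [ZMOD n] := by
  obtain ⟨u, v, huv⟩ := h
  refine ⟨a * (v * n) + b * (u * m), ?_, ?_⟩
  · exact (Int.modEq_of_dvd ⟨u * (b - a), by linear_combination a * huv⟩).symm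
  · exact (Int.modEq_of_dvd ⟨v * (a - b), by linear_combination b * huv⟩).symm

/-- A primitive form represents integers coprime to any given `N ≠ 0`: modulo a prime one of
`f(1, 0)`, `f(0, 1)`, `f(1, 1)` is nonzero, and the Chinese remainder theorem combines primes. -/
theorem IsPrimitive.exists_eval_isCoprime {f : BQForm ℤ} (hf : f.IsPrimitive) (N : ℕ) (hN : N ≠ 0) :
    ∃ v : ℤ × ℤ, IsCoprime (f.eval v.1 v.2) (N : ℤ) := by
  induction N using Nat.recOnPosPrimePosCoprime with
  | zero => exact absurd rfl hN
  | one => exact ⟨(0, 0), by simpa using isCoprime_one_right⟩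
  | prime_pow q n hq _ =>
    have key : ∃ v : ℤ × ℤ, ¬ (q : ℤ) ∣ f.eval v.1 v.2 := by
      by_contra! hcon
      have h1 := hcon (1, 0)
      have h2 := hcon (0, 1)
      have h3 := hcon (1, 1)
      simp only [eval] at h1 h2 h3
      ring_nf at h1 h2 h3
      refine (isPrimitive_iff f).1 hf q hq ⟨h1, ?_, h2⟩
      have h := dvd_sub (dvd_sub h3 h1) h2
      ring_nf at h
      exact h
    obtain ⟨v, hv⟩ := key
    refine ⟨v, ?_⟩
    push_cast
    exact (((Nat.prime_iff_prime_int.1 hq).coprime_iff_not_dvd).2 hv).symm.pow_right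
  | coprime a b ha hb hab iha ihb =>
    obtain ⟨v, hv⟩ := iha (by lia)
    obtain ⟨w, hw⟩ := ihb (by lia)
    have hab' : IsCoprime (a : ℤ) b := Nat.isCoprime_iff_coprime.2 hab
    obtain ⟨x, hx, hx'⟩ := exists_modEq_modEq hab' v.1 w.1
    obtain ⟨y, hy, hy'⟩ := exists_modEq_modEq hab' v.2 w.2
    refine ⟨(x, y), ?_⟩
    push_cast
    exact (isCoprime_of_modEq (f.eval_modEq hx hy) hv).mul_right
      (isCoprime_of_modEq (f.eval_modEq hx' hy') hw)

/-- The vector with value coprime to `N` may be chosen in any residue class modulo an `m` coprime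
to `N`. -/
theorem IsPrimitive.exists_eval_isCoprime_modEq {f : BQForm ℤ} (hf : f.IsPrimitive) {m N : ℤ}
    (hN : N ≠ 0) (hmN : IsCoprime m N) (u : ℤ × ℤ) :
    ∃ v : ℤ × ℤ, v.1 ≡ u.1 [ZMOD m] ∧ v.2 ≡ u.2 [ZMOD m] ∧ IsCoprime (f.eval v.1 v.2) N := by
  obtain ⟨w, hw⟩ := hf.exists_eval_isCoprime N.natAbs (by simpa using hN)
  rw [Int.natCast_natAbs, IsCoprime.abs_right_iff] at hw
  obtain ⟨x, hx, hx'⟩ := exists_modEq_modEq hmN u.1 w.1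
  obtain ⟨y, hy, hy'⟩ := exists_modEq_modEq hmN u.2 w.2
  exact ⟨(x, y), hx, hy, isCoprime_of_modEq (f.eval_modEq hx' hy') hw⟩

/-! ### Sublattices of prime index -/

/-- Points of the projective line over `𝔽_p` correspond to the sublattices of index `p` in `ℤ²`.
They are encoded as `Option (ZMod p)`: `some h` is the line `x = h y` and `none` the line `y = 0`.
`OnLine L v` says that `v` lies in the sublattice of `L`, which contains `pℤ²`. -/
def OnLine {p : ℕ} : Option (ZMod p) → ℤ × ℤ → Prop
  | none, v => (v.2 : ZMod p) = 0
  | some h, v => (v.1 : ZMod p) = h * v.2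

/-- A matrix of determinant `p` whose columns form a basis of the sublattice of `L`. -/
def lineMatrix {p : ℕ} : Option (ZMod p) → Matrix (Fin 2) (Fin 2) ℤ
  | none => !![1, 0; 0, p]
  | some h => !![p, h.val; 0, 1]

/-- The restriction of `f` to the sublattice of `L`, in the basis `lineMatrix L`. -/
def restrict {p : ℕ} (f : BQForm ℤ) (L : Option (ZMod p)) : BQForm ℤ := f.act (lineMatrix L)

section Lines

variable {p : ℕ} [hp : Fact p.Prime]

theorem det_lineMatrix (L : Option (ZMod p)) : (lineMatrix L).det = p := by
  cases L <;> simp [lineMatrix, Matrix.det_fin_two]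

theorem onLine_iff (L : Option (ZMod p)) (v : ℤ × ℤ) :
    OnLine L v ↔ ∃ w, mulPair (lineMatrix L) w = v := by
  have key : ∀ z : ℤ, (z : ZMod p) = 0 ↔ (p : ℤ) ∣ z := fun z => ZMod.intCast_zmod_eq_zero_iff_dvd z p
  obtain ⟨x, y⟩ := v
  cases L with
  | none =>
    simp only [OnLine, key]
    constructor
    · rintro ⟨k, hk⟩
      exact ⟨(x, k), by simp [mulPair, lineMatrix, hk]⟩
    · rintro ⟨w, hw⟩
      simp only [mulPair, lineMatrix, Prod.mk.injEq] at hw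
      exact ⟨w.2, by simpa using hw.2.symm⟩
  | some h =>
    have e : (x : ZMod p) = h * y ↔ (p : ℤ) ∣ x - h.val * y := by
      rw [← key]
      push_cast
      rw [ZMod.natCast_zmod_val, sub_eq_zero]
    simp only [OnLine, e]
    constructor
    · rintro ⟨k, hk⟩
      refine ⟨(k, y), ?_⟩
      simp [mulPair, lineMatrix, -ZMod.natCast_val]
      linear_combination -hk
    · rintro ⟨w, hw⟩
      simp [mulPair, lineMatrix, -ZMod.natCast_val] at hw
      exact ⟨w.1, by rw [← hw.1, ← hw.2]; ring⟩

/-- A vector `v` of the sublattice that is nonzero modulo `p` determines it: `w` belongs to it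
exactly when the determinant of `v` and `w` vanishes modulo `p`. -/
theorem onLine_iff_wedge {L : Option (ZMod p)} {v : ℤ × ℤ} (hv : OnLine L v)
    (h0 : ¬ ((v.1 : ZMod p) = 0 ∧ (v.2 : ZMod p) = 0)) (w : ℤ × ℤ) :
    OnLine L w ↔ (v.1 : ZMod p) * w.2 = v.2 * w.1 := by
  cases L with
  | none =>
    simp only [OnLine] at hv ⊢
    have : (v.1 : ZMod p) ≠ 0 := fun h => h0 ⟨h, hv⟩
    simp [hv, this]
  | some h =>
    simp only [OnLine] at hv ⊢
    have : (v.2 : ZMod p) ≠ 0 := fun h => h0 ⟨by rw [hv, h, mul_zero], h⟩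
    rw [hv, mul_right_comm, mul_comm _ (v.2 : ZMod p), mul_right_inj' this, eq_comm]

theorem exists_onLine (v : ℤ × ℤ) : ∃ L : Option (ZMod p), OnLine L v := by
  by_cases h : (v.2 : ZMod p) = 0
  · exact ⟨none, h⟩
  · exact ⟨some (v.1 / v.2), by simp [OnLine, h]⟩

theorem onLine_of_eq_zero (L : Option (ZMod p)) {v : ℤ × ℤ} (h1 : (v.1 : ZMod p) = 0)
    (h2 : (v.2 : ZMod p) = 0) : OnLine L v := by
  cases L <;> simp [OnLine, h1, h2]

theorem OnLine.unique {L L' : Option (ZMod p)} {v : ℤ × ℤ} (hv : OnLine L v) (hv' : OnLine L' v)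
    (h0 : ¬ ((v.1 : ZMod p) = 0 ∧ (v.2 : ZMod p) = 0)) : L = L' := by
  cases L <;> cases L' <;> simp only [OnLine] at hv hv'
  · rfl
  · exact absurd ⟨by rw [hv', hv, mul_zero], hv⟩ h0
  · exact absurd ⟨by rw [hv, hv', mul_zero], hv'⟩ h0
  · have : (v.2 : ZMod p) ≠ 0 := fun h => h0 ⟨by rw [hv, h, mul_zero], h⟩
    rw [mul_right_cancel₀ this (hv.symm.trans hv')]

theorem OnLine.exists_eq_mul {L : Option (ZMod p)} {v w : ℤ × ℤ} (hv : OnLine L v)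
    (hw : OnLine L w) (h0 : ¬ ((v.1 : ZMod p) = 0 ∧ (v.2 : ZMod p) = 0)) :
    ∃ k : ZMod p, (w.1 : ZMod p) = k * v.1 ∧ (w.2 : ZMod p) = k * v.2 := by
  have h := (onLine_iff_wedge hv h0 w).1 hw
  by_cases h2 : (v.2 : ZMod p) = 0
  · have h1 : (v.1 : ZMod p) ≠ 0 := fun h => h0 ⟨h, h2⟩
    exact ⟨w.1 / v.1, by field_simp, by field_simp; linear_combination h⟩
  · exact ⟨w.2 / v.2, by field_simp; linear_combination -h, by field_simp⟩

theorem intCast_eval (f : BQForm ℤ) (x y : ℤ) :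
    ((f.eval x y : ℤ) : ZMod p) = f.a * x ^ 2 + f.b * x * y + f.c * y ^ 2 := by
  simp [eval]

theorem not_zero_of_eval {f : BQForm ℤ} {v : ℤ × ℤ} (h : ((f.eval v.1 v.2 : ℤ) : ZMod p) ≠ 0) :
    ¬ ((v.1 : ZMod p) = 0 ∧ (v.2 : ZMod p) = 0) := by
  rintro ⟨h1, h2⟩
  exact h (by rw [intCast_eval, h1, h2]; ring)

/-- All values of `f` on one line are the same up to squares modulo `p`. -/
theorem OnLine.exists_eval_eq {L : Option (ZMod p)} {v w : ℤ × ℤ} (f : BQForm ℤ) (hv : OnLine L v)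
    (hw : OnLine L w) (h0 : ¬ ((v.1 : ZMod p) = 0 ∧ (v.2 : ZMod p) = 0)) :
    ∃ k : ZMod p, ((f.eval w.1 w.2 : ℤ) : ZMod p) = k ^ 2 * (f.eval v.1 v.2 : ℤ) := by
  obtain ⟨k, h1, h2⟩ := hv.exists_eq_mul hw h0
  exact ⟨k, by rw [intCast_eval, intCast_eval, h1, h2]; ring⟩

theorem exists_eval_restrict (f : BQForm ℤ) (L : Option (ZMod p)) (n : ℤ) :
    (∃ w : ℤ × ℤ, (f.restrict L).eval w.1 w.2 = n) ↔
      ∃ v : ℤ × ℤ, OnLine L v ∧ f.eval v.1 v.2 = n := by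
  simp only [onLine_iff, restrict, ← eval_mulPair]
  constructor
  · rintro ⟨w, hw⟩
    exact ⟨_, ⟨w, rfl⟩, hw⟩
  · rintro ⟨v, ⟨w, rfl⟩, hw⟩
    exact ⟨w, hw⟩

theorem repCount_restrict (f : BQForm ℤ) (L : Option (ZMod p)) (n : ℕ) :
    (f.restrict L).repCount n = {v : ℤ × ℤ | OnLine L v ∧ f.eval v.1 v.2 = n}.ncard := by
  have hd : (lineMatrix L).det ≠ 0 := by
    rw [det_lineMatrix]; exact_mod_cast hp.out.ne_zero
  rw [repCount, ← Set.ncard_image_of_injective _ (mulPair_injective hd)]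
  congr 1
  ext v
  simp only [Set.mem_image, Set.mem_ofPred_eq, restrict, ← eval_mulPair, onLine_iff]
  constructor
  · rintro ⟨w, hw, rfl⟩
    exact ⟨⟨w, rfl⟩, hw⟩
  · rintro ⟨⟨w, rfl⟩, hw⟩
    exact ⟨w, hw, rfl⟩

theorem disc_restrict (f : BQForm ℤ) (L : Option (ZMod p)) :
    (f.restrict L).disc = f.disc * (p : ℤ) ^ 2 := by
  rw [restrict, disc_act, det_lineMatrix]

theorem IsPosDef.restrict {f : BQForm ℤ} (hf : f.IsPosDef) (L : Option (ZMod p)) :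
    (f.restrict L).IsPosDef := by
  have hp0 : (0 : ℤ) < p := by exact_mod_cast hp.out.pos
  refine ⟨?_, ?_⟩
  · cases L
    · simpa [BQForm.restrict, act, eval, lineMatrix] using hf.1
    · simp only [BQForm.restrict, act, eval, lineMatrix]
      simp
      exact mul_pos hf.1 (pow_pos hp0 2)
  · rw [disc_restrict]
    exact mul_neg_of_neg_of_pos hf.2 (by positivity)

/-- The restriction is primitive exactly when the line is not isotropic modulo `p`. A prime
`q ≠ p` cannot divide all coefficients, since composing with the adjugate gives back `p² f`. -/
theorem isPrimitive_restrict_iff {f : BQForm ℤ} (hf : f.IsPrimitive) (L : Option (ZMod p)) :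
    (f.restrict L).IsPrimitive ↔
      ∃ v : ℤ × ℤ, OnLine L v ∧ ((f.eval v.1 v.2 : ℤ) : ZMod p) ≠ 0 := by
  constructor
  · intro h
    obtain ⟨w, hw⟩ := h.exists_eval_isCoprime p hp.out.ne_zero
    refine ⟨mulPair (lineMatrix L) w, (onLine_iff L _).2 ⟨w, rfl⟩, ?_⟩
    rw [eval_mulPair, Ne, ZMod.intCast_zmod_eq_zero_iff_dvd,
      ← (Nat.prime_iff_prime_int.1 hp.out).coprime_iff_not_dvd]
    exact hw.symm
  · rintro ⟨v, hv, hv0⟩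
    rw [isPrimitive_iff] at hf ⊢
    intro q hq ⟨ha, hb, hc⟩
    by_cases hqp : q = p
    · subst hqp
      obtain ⟨w, rfl⟩ := (onLine_iff L v).1 hv
      apply hv0
      rw [ZMod.intCast_zmod_eq_zero_iff_dvd, eval_mulPair]
      exact dvd_add (dvd_add (ha.mul_right _) ((hb.mul_right _).mul_right _)) (hc.mul_right _)
    · have hcop : IsCoprime (q : ℤ) ((p : ℤ) ^ 2) :=
        (Nat.isCoprime_iff_coprime.2 ((Nat.coprime_primes hq hp.out).2 hqp)).pow_right
      have h := dvd_act ha hb hc (lineMatrix L).adjugate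
      rw [restrict, ← act_mul, Matrix.mul_adjugate, det_lineMatrix, act_smul_one] at h
      exact hf q hq ⟨hcop.dvd_of_dvd_mul_left h.1, hcop.dvd_of_dvd_mul_left h.2.1,
        hcop.dvd_of_dvd_mul_left h.2.2⟩

end Lines

/-! ### Genera and represented values -/

section Genus

theorem den_coprime_mul {N : ℤ} {q r : ℚ} (hq : IsCoprime (q.den : ℤ) N) (hr : IsCoprime (r.den : ℤ) N) :
    IsCoprime ((q * r).den : ℤ) N :=
  (hq.mul_left hr).of_isCoprime_of_dvd_left (by exact_mod_cast Rat.mul_den_dvd q r)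

theorem den_coprime_add {N : ℤ} {q r : ℚ} (hq : IsCoprime (q.den : ℤ) N) (hr : IsCoprime (r.den : ℤ) N) :
    IsCoprime ((q + r).den : ℤ) N :=
  (hq.mul_left hr).of_isCoprime_of_dvd_left (by exact_mod_cast Rat.add_den_dvd q r)

theorem den_coprime_div {N s : ℤ} (z : ℤ) (hs : IsCoprime s N) :
    IsCoprime (((z : ℚ) / s).den : ℤ) N :=
  hs.of_isCoprime_of_dvd_left (Rat.divInt_eq_div z s ▸ Rat.den_dvd z s)

theorem SameGenus.symm {D : ℤ} {f g : BQForm ℤ} (h : SameGenus D f g) : SameGenus D g f := by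
  obtain ⟨M, hM, e⟩ := h
  refine ⟨M⁻¹, ?_, ?_⟩
  · intro i j
    rw [Matrix.SpecialLinearGroup.coe_inv, Matrix.adjugate_fin_two]
    fin_cases i <;> fin_cases j <;> simpa using hM _ _
  · rw [e, ← act_mul, ← Matrix.SpecialLinearGroup.coe_mul, mul_inv_cancel,
      Matrix.SpecialLinearGroup.coe_one, act_one]

theorem SameGenus.trans {D : ℤ} {f g h : BQForm ℤ} (h1 : SameGenus D f g) (h2 : SameGenus D g h) :
    SameGenus D f h := by
  obtain ⟨M, hM, e⟩ := h1
  obtain ⟨N, hN, e'⟩ := h2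
  refine ⟨M * N, ?_, ?_⟩
  · intro i j
    rw [Matrix.SpecialLinearGroup.coe_mul, Matrix.mul_apply, Fin.sum_univ_two]
    exact den_coprime_add (den_coprime_mul (hM _ _) (hN _ _)) (den_coprime_mul (hM _ _) (hN _ _))
  · rw [e', e, ← act_mul, Matrix.SpecialLinearGroup.coe_mul]

theorem sameGenus_of_equiv (D : ℤ) {f g : BQForm ℤ} (h : f ≈ g) : SameGenus D f g := by
  obtain ⟨M, rfl⟩ := h
  refine ⟨M.map (Int.castRingHom ℚ), fun i j => ?_, ?_⟩
  · simpa using isCoprime_one_left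
  · ext <;> simp [toRat, act, eval]

/-- Forms in the same genus represent the same integers up to squares of integers coprime to `2D`:
clear the denominators of the transforming matrix. -/
theorem SameGenus.exists_eval_eq {D : ℤ} {f g : BQForm ℤ} (h : SameGenus D f g) (w : ℤ × ℤ) :
    ∃ (s : ℤ) (v : ℤ × ℤ), IsCoprime s (2 * D) ∧ f.eval v.1 v.2 = s ^ 2 * g.eval w.1 w.2 := by
  obtain ⟨M, hM, e⟩ := h
  have key : ∀ i j, ∃ z : ℤ, ((M.1 0 0).den * (M.1 0 1).den * ((M.1 1 0).den * (M.1 1 1).den) : ℚ) *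
      M.1 i j = z := by
    intro i j
    have h0 := (M.1 i j).den_mul_eq_num
    fin_cases i <;> fin_cases j <;> simp only [Fin.zero_eta, Fin.mk_one] at h0 ⊢
    · exact ⟨(M.1 0 0).num * (M.1 0 1).den * ((M.1 1 0).den * (M.1 1 1).den), by
        push_cast; rw [← h0]; ring⟩
    · exact ⟨(M.1 0 1).num * (M.1 0 0).den * ((M.1 1 0).den * (M.1 1 1).den), by
        push_cast; rw [← h0]; ring⟩
    · exact ⟨(M.1 1 0).num * (M.1 0 0).den * ((M.1 0 1).den * (M.1 1 1).den), by
        push_cast; rw [← h0]; ring⟩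
    · exact ⟨(M.1 1 1).num * (M.1 0 0).den * ((M.1 1 0).den * (M.1 0 1).den), by
        push_cast; rw [← h0]; ring⟩
  choose z hz using key
  refine ⟨(M.1 0 0).den * (M.1 0 1).den * ((M.1 1 0).den * (M.1 1 1).den),
    (z 0 0 * w.1 + z 0 1 * w.2, z 1 0 * w.1 + z 1 1 * w.2),
    ((hM _ _).mul_left (hM _ _)).mul_left ((hM _ _).mul_left (hM _ _)), ?_⟩
  have e2 : ((g.eval w.1 w.2 : ℤ) : ℚ) = (f.toRat.act M.1).eval w.1 w.2 := by
    rw [← e]; simp [eval, toRat]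
  rw [← Int.cast_inj (α := ℚ)]
  push_cast
  rw [e2, eval_act]
  simp only [eval, toRat]
  push_cast
  simp only [← hz]
  ring

/-- The matrix of determinant one (if `f(x, y) ≠ 0`) whose first column is `(x, y)` and whose second
column is orthogonal to it. -/
def orthMatrix (f : BQForm ℚ) (x y : ℚ) : Matrix (Fin 2) (Fin 2) ℚ :=
  !![x, -(f.b * x + 2 * f.c * y) / (2 * f.eval x y); y, (2 * f.a * x + f.b * y) / (2 * f.eval x y)]

theorem det_orthMatrix (f : BQForm ℚ) {x y : ℚ} (h : f.eval x y ≠ 0) : (f.orthMatrix x y).det = 1 := by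
  rw [orthMatrix, Matrix.det_fin_two_of]
  field_simp
  simp only [eval]; ring

theorem act_orthMatrix (f : BQForm ℚ) {x y : ℚ} (h : f.eval x y ≠ 0) :
    f.act (f.orthMatrix x y) = ⟨f.eval x y, 0, -f.disc / (4 * f.eval x y)⟩ := by
  have hn : f.eval x y = f.a * x ^ 2 + f.b * x * y + f.c * y ^ 2 := rfl
  ext
  · simp [act, orthMatrix]
  · simp [act, orthMatrix]
    field_simp
    ring
  · simp only [act, orthMatrix]
    simp
    generalize f.eval x y = n at *
    simp only [eval, disc]
    field_simp
    rw [hn]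
    ring

theorem ne_zero_of_isCoprime_two_mul {s D : ℤ} (hs : IsCoprime s (2 * D)) : s ≠ 0 := by
  rintro rfl
  have h := hs.of_mul_right_left
  rw [isCoprime_zero_left] at h
  exact absurd h (by decide)

/-- Two forms of the same discriminant `D` that represent, up to the square of an integer coprime
to `2D`, a common integer coprime to `2D` lie in the same genus. Both are taken over `ℚ` to the
same diagonal form by `orthMatrix`. -/
theorem sameGenus_of_eval_eq {D : ℤ} {f g : BQForm ℤ} (hfg : f.disc = g.disc) {v w : ℤ × ℤ} {s : ℤ}
    (hn : IsCoprime (f.eval v.1 v.2) (2 * D)) (hs : IsCoprime s (2 * D))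
    (h : g.eval w.1 w.2 = s ^ 2 * f.eval v.1 v.2) : SameGenus D f g := by
  have hs0 := ne_zero_of_isCoprime_two_mul hs
  have hn0 := ne_zero_of_isCoprime_two_mul hn
  have hs' : (s : ℚ) ≠ 0 := by exact_mod_cast hs0
  have hf : f.toRat.eval v.1 v.2 = (f.eval v.1 v.2 : ℤ) := by simp [eval, toRat]
  have hg : g.toRat.eval (w.1 / s) (w.2 / s) = (f.eval v.1 v.2 : ℤ) := by
    have := congrArg (Int.cast (R := ℚ)) h
    simp only [eval, toRat] at this ⊢
    push_cast at this ⊢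
    field_simp
    linear_combination this
  have hn' : ((f.eval v.1 v.2 : ℤ) : ℚ) ≠ 0 := by exact_mod_cast hn0
  have hdisc : f.toRat.disc = g.toRat.disc := by
    have := congrArg (Int.cast (R := ℚ)) hfg
    simp only [disc, toRat] at this ⊢
    push_cast at this
    exact this
  let M : Matrix.SpecialLinearGroup (Fin 2) ℚ :=
    ⟨f.toRat.orthMatrix v.1 v.2, det_orthMatrix _ (by rw [hf]; exact hn')⟩
  let N : Matrix.SpecialLinearGroup (Fin 2) ℚ :=
    ⟨g.toRat.orthMatrix (w.1 / s) (w.2 / s), det_orthMatrix _ (by rw [hg]; exact hn')⟩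
  have hMN : f.toRat.act M.1 = g.toRat.act N.1 := by
    rw [act_orthMatrix _ (by rw [hf]; exact hn'), act_orthMatrix _ (by rw [hg]; exact hn'), hf, hg,
      hdisc]
  -- The composite matrix has entries `z / (2 n s)` with `z` an integer; the discriminants agree, so
  -- the middle coefficients have the same parity, which makes every such `z` even.
  obtain ⟨k, hk⟩ : ∃ k, g.b = f.b + 2 * k := by
    have h1 : f.b ^ 2 - 4 * f.a * f.c = g.b ^ 2 - 4 * g.a * g.c := hfg
    have h2 : Even (f.b ^ 2) ↔ Even (g.b ^ 2) := by
      rw [show f.b ^ 2 = g.b ^ 2 + 2 * (2 * f.a * f.c - 2 * g.a * g.c) by linear_combination h1]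
      simp [Int.even_add]
    rw [Int.even_pow' two_ne_zero, Int.even_pow' two_ne_zero] at h2
    obtain ⟨k, hk⟩ := Int.even_sub.2 h2.symm
    exact ⟨k, by linear_combination hk⟩
  refine ⟨M * N⁻¹, ?_, ?_⟩
  · have hns := hn.mul_left hs
    have key : ∀ (q : ℚ) (z : ℤ), q = z / ((f.eval v.1 v.2 * s : ℤ) : ℚ) →
        IsCoprime (q.den : ℤ) (2 * D) := fun q z hq => hq ▸ den_coprime_div z hns
    have hkq : (g.b : ℚ) = f.b + 2 * k := by exact_mod_cast hk
    intro i j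
    rw [Matrix.SpecialLinearGroup.coe_mul, Matrix.SpecialLinearGroup.coe_inv,
      Matrix.adjugate_fin_two, Matrix.mul_apply, Fin.sum_univ_two]
    fin_cases i <;> fin_cases j <;> simp [M, N, orthMatrix, hf, hg]
    · refine key _ (g.a * v.1 * w.1 + (f.b + k) * v.1 * w.2 + f.c * v.2 * w.2) ?_
      simp only [toRat, hkq]; push_cast; field_simp; ring
    · refine key _ (k * v.1 * w.1 + g.c * v.1 * w.2 - f.c * v.2 * w.1) ?_
      simp only [toRat, hkq]; push_cast; field_simp; ring
    · refine key _ (g.a * v.2 * w.1 + k * v.2 * w.2 - f.a * v.1 * w.2) ?_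
      simp only [toRat, hkq]; push_cast; field_simp; ring
    · refine key _ (g.c * v.2 * w.2 + (f.b + k) * v.2 * w.1 + f.a * v.1 * w.1) ?_
      simp only [toRat, hkq]; push_cast; field_simp; ring
  · rw [Matrix.SpecialLinearGroup.coe_mul, act_mul, hMN, ← act_mul,
      ← Matrix.SpecialLinearGroup.coe_mul, mul_inv_cancel, Matrix.SpecialLinearGroup.coe_one, act_one]

end Genus

/-! ### Genera of restrictions: reflections and odd primes -/

section Residues

variable {p : ℕ} [hp : Fact p.Prime]

/-- The prime-to-`p` part `N` of `2D`, with the property it is used for. -/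
theorem exists_coprime_part {D : ℤ} (hD : D ≠ 0) :
    ∃ N : ℤ, N ≠ 0 ∧ IsCoprime (p : ℤ) N ∧
      ∀ s : ℤ, IsCoprime s p → IsCoprime s N → IsCoprime s (2 * (D * (p : ℤ) ^ 2)) := by
  have hpp : Prime (p : ℤ) := Nat.prime_iff_prime_int.1 hp.out
  have hfin : FiniteMultiplicity (p : ℤ) (2 * D) :=
    Int.finiteMultiplicity_iff.2 ⟨by simpa using hp.out.ne_one, by simpa using hD⟩
  obtain ⟨N, hN, hN'⟩ := hfin.exists_eq_pow_mul_and_not_dvd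
  refine ⟨N, ?_, (hpp.coprime_iff_not_dvd).2 hN', fun s h1 h2 => ?_⟩
  · rintro rfl
    exact hN' (dvd_zero _)
  · rw [← mul_assoc, hN]
    exact ((h1.pow_right).mul_right h2).mul_right h1.pow_right

theorem isCoprime_iff_zmod {s : ℤ} : IsCoprime s (p : ℤ) ↔ (s : ZMod p) ≠ 0 := by
  rw [isCoprime_comm, (Nat.prime_iff_prime_int.1 hp.out).coprime_iff_not_dvd, Ne,
    ZMod.intCast_zmod_eq_zero_iff_dvd]

/-- The vector on the left is `s` times the reflection of `v` in `u`. Cancelling a common factor `d`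
of `f(u)` and the polar value lets reflections with `f(u)` divisible by `p` be used as well. -/
theorem eval_reflection {f : BQForm ℤ} {v u : ℤ × ℤ} {d s k : ℤ} (hd : d ≠ 0)
    (hs : f.eval u.1 u.2 = d * s) (hk : f.polar v u = d * k) :
    f.eval (s * v.1 - k * u.1) (s * v.2 - k * u.2) = s ^ 2 * f.eval v.1 v.2 := by
  apply mul_left_cancel₀ hd
  simp only [eval, polar] at *
  linear_combination d * k ^ 2 * hs - d * s * k * hk

/-- A reflection that moves a vector on `L₁` to one on `L₂` puts the two restrictions in one genus. -/
theorem sameGenus_of_reflection {f : BQForm ℤ} {L₁ L₂ : Option (ZMod p)} {v u : ℤ × ℤ} {d s k : ℤ}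
    (hv : OnLine L₁ v) (hn : IsCoprime (f.eval v.1 v.2) (2 * (f.disc * (p : ℤ) ^ 2)))
    (hd : d ≠ 0) (hs : f.eval u.1 u.2 = d * s) (hk : f.polar v u = d * k)
    (hsc : IsCoprime s (2 * (f.disc * (p : ℤ) ^ 2)))
    (hY : OnLine L₂ (s * v.1 - k * u.1, s * v.2 - k * u.2)) :
    SameGenus (f.disc * (p : ℤ) ^ 2) (f.restrict L₁) (f.restrict L₂) := by
  obtain ⟨x, hx⟩ := (exists_eval_restrict f L₁ _).2 ⟨v, hv, rfl⟩
  obtain ⟨y, hy⟩ := (exists_eval_restrict f L₂ _).2 ⟨_, hY, eval_reflection hd hs hk⟩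
  refine sameGenus_of_eval_eq (v := x) (w := y) (s := s) ?_ ?_ hsc ?_
  · rw [disc_restrict, disc_restrict]
  · rw [hx]; exact hn
  · rw [hx]; exact hy

theorem exists_onLine_isCoprime {f : BQForm ℤ} (hf : f.IsPrimitive) (hD : f.disc ≠ 0)
    {L : Option (ZMod p)} {v : ℤ × ℤ} (hv : OnLine L v)
    (h0 : ((f.eval v.1 v.2 : ℤ) : ZMod p) ≠ 0) :
    ∃ w, OnLine L w ∧ IsCoprime (f.eval w.1 w.2) (2 * (f.disc * (p : ℤ) ^ 2)) := by
  have hprim := (isPrimitive_restrict_iff hf L).2 ⟨v, hv, h0⟩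
  have hp0 : (p : ℤ) ≠ 0 := by exact_mod_cast hp.out.ne_zero
  obtain ⟨w, -, -, hw⟩ := hprim.exists_eval_isCoprime_modEq (m := 1)
    (N := 2 * (f.disc * (p : ℤ) ^ 2)) (by positivity) isCoprime_one_left (0, 0)
  obtain ⟨y, hy, hy'⟩ := (exists_eval_restrict f L _).1 ⟨w, rfl⟩
  exact ⟨y, hy, hy' ▸ hw⟩

theorem eval_ne_zero_of_isCoprime {n D : ℤ} (h : IsCoprime n (2 * (D * (p : ℤ) ^ 2))) :
    (n : ZMod p) ≠ 0 := by
  rw [← isCoprime_iff_zmod]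
  exact (h.of_isCoprime_of_dvd_right ⟨2 * D * p, by ring⟩)

/-- Choose `k` with `k² f(w) = f(v)` modulo `p`. The reflection in a vector `u ≡ v - k w` moves `v`
to `k w` modulo `p`. -/
theorem sameGenus_of_isSquare (hp2 : p ≠ 2) {f : BQForm ℤ} (hf : f.IsPrimitive) (hD : f.disc ≠ 0)
    {L₁ L₂ : Option (ZMod p)} {v w : ℤ × ℤ} (hv : OnLine L₁ v) (hw : OnLine L₂ w)
    (hv0 : ((f.eval v.1 v.2 : ℤ) : ZMod p) ≠ 0) (hw0 : ((f.eval w.1 w.2 : ℤ) : ZMod p) ≠ 0)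
    (hsq : IsSquare ((f.eval v.1 v.2 * f.eval w.1 w.2 : ℤ) : ZMod p)) :
    SameGenus (f.disc * (p : ℤ) ^ 2) (f.restrict L₁) (f.restrict L₂) := by
  obtain ⟨v', hv', hc⟩ := exists_onLine_isCoprime hf hD hv hv0
  have hv0' := eval_ne_zero_of_isCoprime hc
  obtain ⟨j, hj⟩ := hv.exists_eval_eq f hv' (not_zero_of_eval hv0)
  obtain ⟨m, hm⟩ := hsq
  push_cast at hm
  have h2 : (2 : ZMod p) ≠ 0 := by
    have : ((2 : ℕ) : ZMod p) ≠ 0 := by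
      rw [Ne, ZMod.natCast_eq_zero_iff]
      exact fun h => hp2 ((Nat.prime_dvd_prime_iff_eq hp.out Nat.prime_two).1 h)
    exact_mod_cast this
  -- The second condition says `f(v' - k w) ≠ 0` modulo `p`; it holds for `k` or for `-k`, as the sum
  -- of the two values is `4 f(v')`.
  have hk : ∃ k : ZMod p, k ^ 2 * (f.eval w.1 w.2 : ℤ) = (f.eval v'.1 v'.2 : ℤ) ∧
      2 * ((f.eval v'.1 v'.2 : ℤ) : ZMod p) - k * (f.polar v' w : ℤ) ≠ 0 := by
    have hk0 : (j * m / (f.eval w.1 w.2 : ℤ)) ^ 2 * ((f.eval w.1 w.2 : ℤ) : ZMod p) =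
        (f.eval v'.1 v'.2 : ℤ) := by
      rw [hj]; field_simp; linear_combination (-(j ^ 2)) * hm
    generalize j * m / ((f.eval w.1 w.2 : ℤ) : ZMod p) = k at hk0
    by_contra! hcon
    have e1 := hcon k hk0
    have e2 := hcon (-k) (by rw [neg_sq]; exact hk0)
    have : (2 : ZMod p) * 2 * (f.eval v'.1 v'.2 : ℤ) = 0 := by linear_combination e1 + e2
    simp [h2, hv0'] at this
  obtain ⟨k, hk1, hk2⟩ := hk
  obtain ⟨κ, rfl⟩ := ZMod.intCast_surjective k
  obtain ⟨N, hN0, hpN, hN⟩ := exists_coprime_part (p := p) hD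
  obtain ⟨u, hu1, hu2, huN⟩ := hf.exists_eval_isCoprime_modEq hN0 hpN
    (v'.1 - κ * w.1, v'.2 - κ * w.2)
  rw [← ZMod.intCast_eq_intCast_iff] at hu1 hu2
  push_cast at hu1 hu2
  have hs : ((f.eval u.1 u.2 : ℤ) : ZMod p) =
      2 * ((f.eval v'.1 v'.2 : ℤ) : ZMod p) - κ * (f.polar v' w : ℤ) := by
    simp only [eval, polar] at hk1 ⊢
    push_cast at hk1 ⊢
    rw [hu1, hu2]
    linear_combination hk1
  have hkk : ((f.polar v' u : ℤ) : ZMod p) = ((f.eval u.1 u.2 : ℤ) : ZMod p) := by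
    rw [hs]
    simp only [eval, polar]
    push_cast
    rw [hu1, hu2]
    ring
  refine sameGenus_of_reflection hv' hc one_ne_zero (one_mul _).symm (one_mul _).symm
    (hN _ ?_ huN) ?_
  · rw [isCoprime_iff_zmod, hs]; exact hk2
  · rw [onLine_iff_wedge hw (not_zero_of_eval hw0)]
    push_cast
    rw [hkk, hu1, hu2]
    ring

theorem SameGenus.isSquare {f : BQForm ℤ} {L₁ L₂ : Option (ZMod p)} {v w : ℤ × ℤ}
    (hv : OnLine L₁ v) (hw : OnLine L₂ w) (hv0 : ((f.eval v.1 v.2 : ℤ) : ZMod p) ≠ 0)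
    (h : SameGenus (f.disc * (p : ℤ) ^ 2) (f.restrict L₁) (f.restrict L₂)) :
    IsSquare ((f.eval v.1 v.2 * f.eval w.1 w.2 : ℤ) : ZMod p) := by
  obtain ⟨y, hy⟩ := (exists_eval_restrict f L₂ _).2 ⟨w, hw, rfl⟩
  obtain ⟨s, x, hs, hx⟩ := h.exists_eval_eq y
  obtain ⟨z, hz, hz'⟩ := (exists_eval_restrict f L₁ _).1 ⟨x, rfl⟩
  obtain ⟨j, hj⟩ := hv.exists_eval_eq f hz (not_zero_of_eval hv0)
  have hs0 := eval_ne_zero_of_isCoprime hs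
  rw [hz', hx, hy] at hj
  refine ⟨j * (f.eval v.1 v.2 : ℤ) / s, ?_⟩
  push_cast at hj ⊢
  field_simp
  linear_combination hj

end Residues

/-! ### Genera of restrictions: the prime two -/

section Two

theorem odd_iff_intCast_ne_zero {z : ℤ} : Odd z ↔ (z : ZMod 2) ≠ 0 := by
  rw [Ne, ZMod.intCast_eq_zero_iff_even, Int.not_even_iff_odd]

/-- On one line modulo two, the odd values of `f` agree modulo `2 ^ (t + 1)`. With `w = v + 2z` the
difference of the values is `2 B(v, z) + 4 f(z)`, where `B` is the polar form. -/
theorem eval_modEq_of_onLine {f : BQForm ℤ} {L : Option (ZMod 2)} {v w : ℤ × ℤ}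
    (hv : OnLine L v) (hw : OnLine L w) (hv0 : Odd (f.eval v.1 v.2)) (hw0 : Odd (f.eval w.1 w.2)) :
    f.eval v.1 v.2 ≡ f.eval w.1 w.2 [ZMOD ((2 ^ (twoExponent f.disc + 1) : ℕ) : ℤ)] := by
  have hz : ∀ z : ZMod 2, z = 0 ∨ z = 1 := by decide
  obtain ⟨k, h1, h2⟩ := hv.exists_eq_mul hw (not_zero_of_eval (odd_iff_intCast_ne_zero.1 hv0))
  have hk : k = 1 := by
    rcases hz k with rfl | rfl
    · exact absurd ⟨by simpa using h1, by simpa using h2⟩ (not_zero_of_eval (odd_iff_intCast_ne_zero.1 hw0))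
    · rfl
  subst hk
  rw [one_mul, ZMod.intCast_eq_intCast_iff] at h1 h2
  obtain ⟨x, hx⟩ := h1.symm.dvd
  obtain ⟨y, hy⟩ := h2.symm.dvd
  rw [sub_eq_iff_eq_add] at hx hy
  push_cast at hx hy
  apply Int.modEq_of_dvd
  have e : f.eval w.1 w.2 - f.eval v.1 v.2 = 2 * f.polar v (x, y) + 4 * f.eval x y := by
    rw [hx, hy]; simp only [eval, polar]; ring
  rw [e]
  unfold twoExponent
  split_ifs with h16 hev
  · obtain ⟨m, hm⟩ := h16
    obtain ⟨b, hb⟩ : Even f.b := by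
      have : Even (f.b ^ 2) := ⟨8 * m + 2 * f.a * f.c, by simp only [disc] at hm; linear_combination hm⟩
      exact (Int.even_pow' two_ne_zero).1 this
    -- From `16 ∣ 4 (b² - ac)`; only the residue modulo two is needed.
    have hbac : (b : ZMod 2) = f.a * f.c := by
      have : b ^ 2 = f.a * f.c + 2 * (2 * m) := by
        simp only [disc, hb] at hm; linarith
      have := congrArg (Int.cast (R := ZMod 2)) this
      push_cast at this
      rw [show (2 : ZMod 2) = 0 from rfl, zero_mul, add_zero] at this
      rw [← this]
      rcases hz b with h | h <;> rw [h] <;> rfl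
    have hv1 : ((f.eval v.1 v.2 : ℤ) : ZMod 2) = 1 := (hz _).resolve_left (odd_iff_intCast_ne_zero.1 hv0)
    obtain ⟨q, hq⟩ : Even (f.a * v.1 * x + b * (v.1 * y + v.2 * x) + f.c * v.2 * y + f.eval x y) := by
      rw [← ZMod.intCast_eq_zero_iff_even]
      simp only [eval, hb] at hv1 ⊢
      push_cast at hv1 ⊢
      rw [hbac] at hv1 ⊢
      generalize (f.a : ZMod 2) = A at *
      generalize (f.c : ZMod 2) = C at *
      generalize (v.1 : ZMod 2) = V at *
      generalize (v.2 : ZMod 2) = W at *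
      generalize (x : ZMod 2) = X at *
      generalize (y : ZMod 2) = Y at *
      clear * - hv1
      revert A C V W X Y
      decide
    refine ⟨q, ?_⟩
    simp only [polar, hb]
    push_cast
    linear_combination 4 * hq
  · obtain ⟨m, hm⟩ := hev
    obtain ⟨b, hb⟩ : Even f.b := by
      have : Even (f.b ^ 2) := ⟨m + 2 * f.a * f.c, by simp only [disc] at hm; linear_combination hm⟩
      exact (Int.even_pow' two_ne_zero).1 this
    refine ⟨f.a * v.1 * x + b * (v.1 * y + v.2 * x) + f.c * v.2 * y + f.eval x y, ?_⟩
    simp only [polar, hb]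
    push_cast
    ring
  · exact ⟨f.polar v (x, y) + 2 * f.eval x y, by push_cast; ring⟩

theorem SameGenus.modEq {f : BQForm ℤ} {L₁ L₂ : Option (ZMod 2)} {v w : ℤ × ℤ}
    (hv : OnLine L₁ v) (hw : OnLine L₂ w) (hv0 : Odd (f.eval v.1 v.2)) (hw0 : Odd (f.eval w.1 w.2))
    (h : SameGenus (f.disc * ((2 : ℕ) : ℤ) ^ 2) (f.restrict L₁) (f.restrict L₂)) :
    f.eval v.1 v.2 ≡ f.eval w.1 w.2 [ZMOD ((2 ^ (twoExponent f.disc + 1) : ℕ) : ℤ)] := by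
  obtain ⟨y, hy⟩ := (exists_eval_restrict f L₂ _).2 ⟨w, hw, rfl⟩
  obtain ⟨s, x, hs, hx⟩ := h.exists_eval_eq y
  obtain ⟨z, hz, hz'⟩ := (exists_eval_restrict f L₁ _).1 ⟨x, rfl⟩
  rw [hx, hy] at hz'
  have hs1 : Odd s := by
    rw [← Int.not_even_iff_odd, even_iff_two_dvd]
    exact fun h => Int.prime_two.not_isUnit (hs.isUnit_of_dvd' h (dvd_mul_right _ _))
  have hz0 : Odd (f.eval z.1 z.2) := hz' ▸ hs1.pow.mul hw0
  refine (eval_modEq_of_onLine hv hz hv0 hz0).trans ?_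
  have h8 : s ^ 2 ≡ 1 [ZMOD 8] := by
    obtain ⟨m, rfl⟩ := hs1
    obtain ⟨q, hq⟩ := Int.even_mul_succ_self m
    exact (Int.modEq_of_dvd ⟨q, by linear_combination 4 * hq⟩).symm
  have hdvd : ((2 ^ (twoExponent f.disc + 1) : ℕ) : ℤ) ∣ 8 := by
    unfold twoExponent
    split_ifs <;> norm_num
  rw [hz']
  simpa using (h8.of_dvd hdvd).mul_right (f.eval w.1 w.2)

/-- Reflection in a vector `u ≡ v + ε w` modulo `16`, when `f(u)` and the polar value of `v` and `u`
are the same power `d` of two times odd numbers. It moves `v` to `-ε w` modulo two. -/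
theorem sameGenus_of_dyadic_reflection {f : BQForm ℤ} (hf : f.IsPrimitive) (hD : f.disc ≠ 0)
    {L₁ L₂ : Option (ZMod 2)} {v w : ℤ × ℤ} (hv : OnLine L₁ v) (hw : OnLine L₂ w)
    (hn : IsCoprime (f.eval v.1 v.2) (2 * (f.disc * ((2 : ℕ) : ℤ) ^ 2)))
    (hw0 : Odd (f.eval w.1 w.2)) {ε d e s k : ℤ} (hde : 2 * d * e = 16)
    (hs : f.eval (v.1 + ε * w.1) (v.2 + ε * w.2) = d * s) (hso : Odd s)
    (hk : f.polar v (v.1 + ε * w.1, v.2 + ε * w.2) = d * k) (hko : Odd k) :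
    SameGenus (f.disc * ((2 : ℕ) : ℤ) ^ 2) (f.restrict L₁) (f.restrict L₂) := by
  have hd : d ≠ 0 := by rintro rfl; simp at hde
  obtain ⟨N, hN0, hpN, hN⟩ := exists_coprime_part (p := 2) hD
  obtain ⟨u, hu1, hu2, huN⟩ := hf.exists_eval_isCoprime_modEq hN0
    (hpN.pow_left (m := 4)) (v.1 + ε * w.1, v.2 + ε * w.2)
  push_cast at hu1 hu2
  have es := (f.eval_modEq hu1 hu2).symm.dvd
  have ek := (f.polar_modEq v (w := u) (w' := (v.1 + ε * w.1, v.2 + ε * w.2)) hu1 hu2).symm.dvd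
  obtain ⟨i, hi⟩ := es
  obtain ⟨j, hj⟩ := ek
  have hs' : f.eval u.1 u.2 = d * (s + 2 * (e * i)) := by linear_combination hs + hi - i * hde
  have hk' : f.polar v u = d * (k + 2 * (e * j)) := by linear_combination hk + hj - j * hde
  have hso' : Odd (s + 2 * (e * i)) := hso.add_even (even_two_mul _)
  have hko' : Odd (k + 2 * (e * j)) := hko.add_even (even_two_mul _)
  have c1 : ∀ {z : ℤ}, Odd z → (z : ZMod 2) = 1 := fun h => by
    obtain ⟨m, rfl⟩ := h
    push_cast
    rw [show (2 : ZMod 2) = 0 from rfl]; simp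
  refine sameGenus_of_reflection hv hn hd hs' hk' (hN _ ?_ ?_) ?_
  · rw [isCoprime_iff_zmod, c1 hso']; exact one_ne_zero
  · rw [hs'] at huN; exact huN.of_mul_left_right
  · have hd2 : ((2 : ℕ) : ℤ) ∣ 2 ^ 4 := by norm_num
    have hu1' := (ZMod.intCast_eq_intCast_iff _ _ 2).2 (hu1.of_dvd hd2)
    have hu2' := (ZMod.intCast_eq_intCast_iff _ _ 2).2 (hu2.of_dvd hd2)
    rw [onLine_iff_wedge hw (not_zero_of_eval (by rw [c1 hw0]; exact one_ne_zero))]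
    rw [Int.cast_sub, Int.cast_sub, Int.cast_mul, Int.cast_mul, Int.cast_mul, Int.cast_mul,
      c1 hso', c1 hko', hu1', hu2']
    push_cast
    ring

/-- For distinct lines, `v` and `w` span a sublattice of odd index, so that the Gram discriminant
`B² - 4ac` of `a = f(v)`, `B`, `c = f(w)` is `disc f` times an odd square. A suitable reflection in
`v ± w` then exists, with `d = 4`, `2`, `1` for `t = 2`, `1`, `0`. -/
theorem sameGenus_of_modEq {f : BQForm ℤ} (hf : f.IsPrimitive) (hD : f.disc ≠ 0)
    {L₁ L₂ : Option (ZMod 2)} {v w : ℤ × ℤ} (hv : OnLine L₁ v) (hw : OnLine L₂ w)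
    (hv0 : Odd (f.eval v.1 v.2)) (hw0 : Odd (f.eval w.1 w.2))
    (h : f.eval v.1 v.2 ≡ f.eval w.1 w.2 [ZMOD ((2 ^ (twoExponent f.disc + 1) : ℕ) : ℤ)]) :
    SameGenus (f.disc * ((2 : ℕ) : ℤ) ^ 2) (f.restrict L₁) (f.restrict L₂) := by
  by_cases hL : L₁ = L₂
  · subst hL
    exact sameGenus_of_equiv _ (Setoid.refl _)
  obtain ⟨v', hv', hc⟩ := exists_onLine_isCoprime hf hD hv (odd_iff_intCast_ne_zero.1 hv0)
  have hv0' := odd_iff_intCast_ne_zero.2 (eval_ne_zero_of_isCoprime hc)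
  replace h := (eval_modEq_of_onLine hv' hv hv0' hv0).trans h
  have hδ : Odd (v'.1 * w.2 - v'.2 * w.1) := by
    rw [odd_iff_intCast_ne_zero]
    intro h0
    apply hL
    refine OnLine.unique
      ((onLine_iff_wedge hv' (not_zero_of_eval (odd_iff_intCast_ne_zero.1 hv0')) w).2 ?_) hw
      (not_zero_of_eval (odd_iff_intCast_ne_zero.1 hw0))
    push_cast at h0
    linear_combination h0
  have hgram : f.polar v' w ^ 2 - 4 * f.eval v'.1 v'.2 * f.eval w.1 w.2 =
      f.disc * (v'.1 * w.2 - v'.2 * w.1) ^ 2 := by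
    simp only [polar, eval, disc]; ring
  have hse : ∀ ε, f.eval (v'.1 + ε * w.1) (v'.2 + ε * w.2) =
      f.eval v'.1 v'.2 + ε * f.polar v' w + ε ^ 2 * f.eval w.1 w.2 := by
    intro ε; simp only [polar, eval]; ring
  have hke : ∀ ε, f.polar v' (v'.1 + ε * w.1, v'.2 + ε * w.2) =
      2 * f.eval v'.1 v'.2 + ε * f.polar v' w := by
    intro ε; simp only [polar, eval]; ring
  have core := fun ε d e s k hde hs hso hk hko => sameGenus_of_dyadic_reflection (ε := ε) (d := d)
    (e := e) (s := s) (k := k) hf hD hv' hw hc hw0 hde (by rw [hse]; exact hs) hso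
    (by rw [hke]; exact hk) hko
  generalize f.polar v' w = B at *
  generalize f.eval v'.1 v'.2 = a at *
  generalize f.eval w.1 w.2 = c at *
  generalize v'.1 * w.2 - v'.2 * w.1 = δ at *
  clear hse hke hv hw hv' hv0 hL hc
  obtain ⟨a', rfl⟩ := hv0'
  obtain ⟨c', rfl⟩ := hw0
  have hBD : Even B ↔ Even f.disc := by
    have e1 : Even (B ^ 2) ↔ Even (f.disc * δ ^ 2) := by
      rw [← hgram]; simp [Int.even_sub, show Even (4 : ℤ) from ⟨2, rfl⟩]
    have : ¬ Even δ := Int.not_even_iff_odd.2 hδ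
    rw [Int.even_pow' two_ne_zero, Int.even_mul, Int.even_pow' two_ne_zero] at e1
    tauto
  have h16 : (16 : ℤ) ∣ f.disc ↔ (16 : ℤ) ∣ B ^ 2 - 4 * (2 * a' + 1) * (2 * c' + 1) := by
    rw [hgram]
    have : IsCoprime (16 : ℤ) (δ ^ 2) := by
      have : IsCoprime (2 : ℤ) δ := (Int.prime_two.coprime_iff_not_dvd).2
        (fun h => Int.not_even_iff_odd.2 hδ (even_iff_two_dvd.2 h))
      exact (this.pow_left (m := 4)).pow_right
    exact ⟨fun h => h.mul_right _, this.dvd_of_dvd_mul_right⟩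
  unfold twoExponent at h
  split_ifs at h with hd1 hd2
  · obtain ⟨b, rfl⟩ : Even B := hBD.2 (even_iff_two_dvd.2 (dvd_trans (by norm_num) hd1))
    rw [h16] at hd1
    obtain ⟨m, hm⟩ := hd1
    obtain ⟨n, hn⟩ := h.dvd
    push_cast at hn
    have hbo : Odd b := by
      rw [← Int.not_even_iff_odd]
      rintro ⟨b', rfl⟩
      ring_nf at hm
      lia
    obtain ⟨b', rfl⟩ := hbo
    obtain rfl : c' = a' + 4 * n := by linarith
    -- The sign is chosen so that `f(v) ± B / 2` is twice an odd number.
    rcases Int.even_or_odd (a' + b') with ⟨i, hi⟩ | ⟨i, hi⟩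
    · obtain rfl : b' = 2 * i - a' := by linarith
      exact core 1 4 2 (2 * i + 1 + 2 * n) (2 * i + 1) (by norm_num) (by ring)
        ⟨i + n, by ring⟩ (by ring) ⟨i, rfl⟩
    · obtain rfl : b' = 2 * i + 1 - a' := by linarith
      exact core (-1) 4 2 (2 * a' - 2 * i - 1 + 2 * n) (2 * a' - 2 * i - 1) (by norm_num) (by ring)
        ⟨a' - i - 1 + n, by ring⟩ (by ring) ⟨a' - i - 1, by ring⟩
  · obtain ⟨b, rfl⟩ : Even B := hBD.2 hd2
    rw [h16] at hd1
    obtain ⟨n, hn⟩ := h.dvd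
    push_cast at hn
    -- If `b` were odd, then `b² ≡ 1 ≡ ac` modulo four, and `16` would divide the discriminant.
    have hbe : Even b := by
      rw [← Int.not_odd_iff_even]
      rintro ⟨b', rfl⟩
      apply hd1
      have hcc : c' = a' + 2 * n := by linarith
      refine ⟨b' ^ 2 + b' - a' ^ 2 - a' - 2 * a' * n - n, ?_⟩
      rw [hcc]
      ring
    obtain ⟨b', rfl⟩ := hbe
    obtain rfl : c' = a' + 2 * n := by linarith
    exact core 1 2 4 (2 * a' + 1 + 2 * n + 2 * b') (2 * a' + 1 + 2 * b') (by norm_num) (by ring)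
      ⟨a' + n + b', by ring⟩ (by ring) ⟨a' + b', by ring⟩
  · have hB : Odd B := by rwa [← Int.not_even_iff_odd, hBD]
    obtain ⟨b, rfl⟩ := hB
    exact core 1 1 8 (2 * a' + 2 * b + 2 * c' + 3) (4 * a' + 2 * b + 3) (by norm_num) (by ring)
      ⟨a' + b + c' + 1, by ring⟩ (by ring) ⟨2 * a' + b + 1, by ring⟩

end Two

/-! ### Proper automorphs -/

section Automorphs

/-- The matrix `e + u ω` with `ω = (0, -c; a, b)`, the action on the lattice of `f` of an element of
the quadratic order of discriminant `disc f`. -/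
def similitude (f : BQForm ℤ) (e u : ℤ) : Matrix (Fin 2) (Fin 2) ℤ :=
  !![e, -(f.c * u); f.a * u, e + f.b * u]

/-- The norm of the order element `e + u ω`. -/
def orderNorm (f : BQForm ℤ) (e u : ℤ) : ℤ := e ^ 2 + f.b * e * u + f.a * f.c * u ^ 2

theorem det_similitude (f : BQForm ℤ) (e u : ℤ) : (f.similitude e u).det = f.orderNorm e u := by
  rw [similitude, Matrix.det_fin_two_of, orderNorm]; ring

theorem act_similitude (f : BQForm ℤ) (e u : ℤ) : f.act (f.similitude e u) =
    ⟨f.orderNorm e u * f.a, f.orderNorm e u * f.b, f.orderNorm e u * f.c⟩ := by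
  ext <;> simp [act, eval, similitude, orderNorm] <;> ring

/-- For primitive `f`, every integral matrix that multiplies `f` by its determinant comes from the
order. -/
theorem IsPrimitive.exists_eq_similitude {f : BQForm ℤ} (hf : f.IsPrimitive)
    {Y : Matrix (Fin 2) (Fin 2) ℤ} {m : ℤ} (hm : m ≠ 0) (hdet : Y.det = m)
    (h : f.act Y = ⟨m * f.a, m * f.b, m * f.c⟩) : ∃ e u, Y = f.similitude e u := by
  have hA : (f.act Y).a = m * f.a := by rw [h]
  have hB : (f.act Y).b = m * f.b := by rw [h]
  have hC : (f.act Y).c = m * f.c := by rw [h]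
  simp only [BQForm.act, eval] at hA hB hC
  rw [Matrix.det_fin_two] at hdet
  obtain ⟨α, β, γ, hb⟩ := hf.exists_bezout
  have hYe := Matrix.eta_fin_two Y
  generalize Y 0 0 = y₁ at *
  generalize Y 0 1 = y₂ at *
  generalize Y 1 0 = y₃ at *
  generalize Y 1 1 = y₄ at *
  -- With `S` the Gram matrix, `Yᵀ S Y = m S` means `S Y = (adj Y)ᵀ S`. These linear equations say
  -- that `(y₃, y₄ - y₁, -y₂)` is proportional to `(a, b, c)`.
  have e1 : f.a * (y₁ - y₄) + f.b * y₃ = 0 := by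
    apply mul_left_cancel₀ (mul_ne_zero two_ne_zero hm)
    linear_combination 2 * y₄ * hA - y₃ * hB - (2 * f.a * y₁ + f.b * y₃) * hdet
  have e2 : f.a * y₂ + f.c * y₃ = 0 := by
    apply mul_left_cancel₀ (mul_ne_zero two_ne_zero hm)
    linear_combination y₄ * hB - 2 * y₃ * hC - (2 * f.a * y₂ + f.b * y₄) * hdet
  have e3 : f.b * y₂ + f.c * (y₄ - y₁) = 0 := by
    apply mul_left_cancel₀ (mul_ne_zero two_ne_zero hm)
    linear_combination - y₂ * hB + 2 * y₁ * hC - (f.b * y₂ + 2 * f.c * y₄) * hdet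
  refine ⟨y₁, α * y₃ + β * (y₄ - y₁) - γ * y₂, ?_⟩
  have h₂ : -(f.c * (α * y₃ + β * (y₄ - y₁) - γ * y₂)) = y₂ := by
    linear_combination y₂ * hb - α * e2 - β * e3
  have h₃ : f.a * (α * y₃ + β * (y₄ - y₁) - γ * y₂) = y₃ := by
    linear_combination y₃ * hb - β * e1 - γ * e2
  have h₄ : y₁ + f.b * (α * y₃ + β * (y₄ - y₁) - γ * y₂) = y₄ := by
    linear_combination (y₄ - y₁) * hb + α * e1 - γ * e3
  rw [hYe, similitude, h₂, h₃, h₄]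

/-- Representatives `S` up to sign of the units of the order. Two different representatives have
determinant `±1`, so their lines stay different modulo every prime. -/
theorem exists_units (f : BQForm ℤ) (hD : f.disc < 0) :
    ∃ S : Finset (ℤ × ℤ), S.card = unitWeight f.disc ∧ (∀ s ∈ S, f.orderNorm s.1 s.2 = 1) ∧
      (∀ e u, f.orderNorm e u = 1 → (e, u) ∈ S ∨ (-e, -u) ∈ S) ∧
      ∀ s ∈ S, ∀ t ∈ S, s ≠ t → IsUnit (s.1 * t.2 - s.2 * t.1) := by
  have hnorm : ∀ e u, f.orderNorm e u = 1 ↔ (2 * e + f.b * u) ^ 2 - f.disc * u ^ 2 = 4 := by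
    intro e u
    simp only [orderNorm, disc]
    constructor <;> intro h <;> linarith
  have hdisc : f.disc = f.b ^ 2 - 4 * f.a * f.c := rfl
  simp only [hnorm]
  unfold unitWeight
  split_ifs with h3 h4
  · obtain ⟨b, hb⟩ : Odd f.b := by
      rw [← Int.not_even_iff_odd]
      rintro ⟨b, hb⟩
      rw [h3, hb] at hdisc
      ring_nf at hdisc
      lia
    refine ⟨{(1, 0), (-b, 1), (-b - 1, 1)}, ?_, ?_, ?_, ?_⟩
    · rw [Finset.card_insert_of_notMem, Finset.card_pair] <;> simp
      lia
    · simp only [Finset.mem_insert, Finset.mem_singleton, h3, hb]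
      rintro s (rfl | rfl | rfl) <;> ring
    · intro e u h
      rw [h3, hb] at h
      have hu : u ^ 2 ≤ 1 := by nlinarith [sq_nonneg (2 * e + (2 * b + 1) * u)]
      obtain ⟨hu1, hu2⟩ := abs_le.1 ((sq_le_one_iff_abs_le_one u).1 hu)
      simp only [Finset.mem_insert, Finset.mem_singleton, Prod.mk.injEq]
      interval_cases u
      · have : (2 * e - (2 * b + 1) - 1) * (2 * e - (2 * b + 1) + 1) = 0 := by linear_combination h
        rcases mul_eq_zero.1 this with h | h <;> lia
      · have : (e - 1) * (e + 1) = 0 := by linarith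
        rcases mul_eq_zero.1 this with h | h <;> lia
      · have : (2 * e + (2 * b + 1) - 1) * (2 * e + (2 * b + 1) + 1) = 0 := by linear_combination h
        rcases mul_eq_zero.1 this with h | h <;> lia
    · simp only [Finset.mem_insert, Finset.mem_singleton, Int.isUnit_iff]
      rintro s (rfl | rfl | rfl) t (rfl | rfl | rfl) hst <;> first | exact absurd rfl hst | skip
      all_goals ring_nf
      all_goals simp
  · obtain ⟨b, hb⟩ : Even f.b := by
      rw [← Int.not_odd_iff_even]
      rintro ⟨b, hb⟩
      rw [h4, hb] at hdisc
      ring_nf at hdisc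
      lia
    refine ⟨{(1, 0), (-b, 1)}, ?_, ?_, ?_, ?_⟩
    · rw [Finset.card_pair]; simp
    · simp only [Finset.mem_insert, Finset.mem_singleton, h4, hb]
      rintro s (rfl | rfl) <;> ring
    · intro e u h
      rw [h4, hb] at h
      have hu : u ^ 2 ≤ 1 := by nlinarith [sq_nonneg (2 * e + (b + b) * u)]
      obtain ⟨hu1, hu2⟩ := abs_le.1 ((sq_le_one_iff_abs_le_one u).1 hu)
      simp only [Finset.mem_insert, Finset.mem_singleton, Prod.mk.injEq]
      interval_cases u
      · have : (e - b) ^ 2 = 0 := by linarith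
        have := pow_eq_zero_iff two_ne_zero |>.1 this
        lia
      · have : (e - 1) * (e + 1) = 0 := by linarith
        rcases mul_eq_zero.1 this with h | h <;> lia
      · have : (e + b) ^ 2 = 0 := by linarith
        have := pow_eq_zero_iff two_ne_zero |>.1 this
        lia
    · simp only [Finset.mem_insert, Finset.mem_singleton, Int.isUnit_iff]
      rintro s (rfl | rfl) t (rfl | rfl) hst <;> first | exact absurd rfl hst | skip
      all_goals simp
  · have hlt : f.disc < -4 := by
      rcases Int.even_or_odd' f.b with ⟨b, hb | hb⟩ <;> rw [hb] at hdisc <;> ring_nf at hdisc <;> lia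
    refine ⟨{(1, 0)}, by simp, by simp, ?_, ?_⟩
    · intro e u h
      have hu : u = 0 := by
        by_contra hu
        have : 0 < u ^ 2 := by positivity
        nlinarith [sq_nonneg (2 * e + f.b * u)]
      subst hu
      have : (e - 1) * (e + 1) = 0 := by linarith
      simp only [Finset.mem_singleton, Prod.mk.injEq]
      rcases mul_eq_zero.1 this with h | h <;> lia
    · simp only [Finset.mem_singleton]
      rintro s rfl t rfl h
      exact absurd rfl h

end Automorphs

/-! ### Lines with equivalent restrictions -/

section Fibers

variable {p : ℕ} [hp : Fact p.Prime]

theorem OnLine.of_eq_mul {L : Option (ZMod p)} {v w : ℤ × ℤ} (hv : OnLine L v) (k : ZMod p)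
    (h1 : (w.1 : ZMod p) = k * v.1) (h2 : (w.2 : ZMod p) = k * v.2) : OnLine L w := by
  cases L <;> simp only [OnLine] at hv ⊢ <;> simp only [h1, h2, hv] <;> ring

theorem restrict_equiv_of_onLine {f : BQForm ℤ} {L L₀ : Option (ZMod p)} {v : ℤ × ℤ}
    (hv : OnLine L₀ v) (hv0 : ((f.eval v.1 v.2 : ℤ) : ZMod p) ≠ 0) {e u : ℤ}
    (h : f.orderNorm e u = 1) (hL : OnLine L (mulPair (f.similitude e u) v)) :
    f.restrict L ≈ f.restrict L₀ := by
  have key : ∀ w, ∃ z, mulPair (lineMatrix L) z =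
      mulPair (f.similitude e u * lineMatrix L₀) w := by
    intro w
    obtain ⟨k, h1, h2⟩ := hv.exists_eq_mul ((onLine_iff L₀ _).2 ⟨w, rfl⟩) (not_zero_of_eval hv0)
    rw [← onLine_iff, mulPair_mul]
    generalize mulPair (lineMatrix L₀) w = x at *
    refine hL.of_eq_mul k ?_ ?_ <;> simp only [mulPair] <;> push_cast <;> rw [h1, h2] <;> ring
  obtain ⟨z₁, hz₁⟩ := key (1, 0)
  obtain ⟨z₂, hz₂⟩ := key (0, 1)
  set N : Matrix (Fin 2) (Fin 2) ℤ := !![z₁.1, z₂.1; z₁.2, z₂.2] with hN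
  have hmul : lineMatrix L * N = f.similitude e u * lineMatrix L₀ := by
    simp only [mulPair, Prod.mk.injEq, mul_one, mul_zero, add_zero, zero_add] at hz₁ hz₂
    ext i j
    rw [Matrix.mul_apply, Fin.sum_univ_two]
    fin_cases i <;> fin_cases j
    · simpa [hN] using hz₁.1
    · simpa [hN] using hz₂.1
    · simpa [hN] using hz₁.2
    · simpa [hN] using hz₂.2
  have hdet : N.det = 1 := by
    have := congrArg Matrix.det hmul
    rw [Matrix.det_mul, Matrix.det_mul, det_lineMatrix, det_lineMatrix, det_similitude, h,
      one_mul] at this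
    exact mul_left_cancel₀ (by exact_mod_cast hp.out.ne_zero) (this.trans (mul_one _).symm)
  refine ⟨⟨N, hdet⟩, ?_⟩
  change f.act _ = (f.act _).act N
  rw [← act_mul, hmul, act_mul, act_similitude, h]
  simp

/-- An equivalence between restrictions is induced by an automorph of `f`. A priori it only gives an
order element `y + u ω` of norm `p²` that maps `v` to `p z` with `z` on `L`. Since `p` does not
divide `f(v)`, the element is divisible by `p`. -/
theorem exists_onLine_of_restrict_equiv {f : BQForm ℤ} (hf : f.IsPrimitive)
    {L L₀ : Option (ZMod p)} {v : ℤ × ℤ}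
    (hv : OnLine L₀ v) (hv0 : ((f.eval v.1 v.2 : ℤ) : ZMod p) ≠ 0)
    (h : f.restrict L ≈ f.restrict L₀) :
    ∃ e u, f.orderNorm e u = 1 ∧ OnLine L (mulPair (f.similitude e u) v) := by
  obtain ⟨N, hN⟩ := h
  have hp0 : (p : ℤ) ≠ 0 := by exact_mod_cast hp.out.ne_zero
  have hpp : Prime (p : ℤ) := Nat.prime_iff_prime_int.1 hp.out
  have hdet : (lineMatrix L * N.1 * (lineMatrix L₀).adjugate).det = (p : ℤ) ^ 2 := by
    rw [Matrix.det_mul, Matrix.det_mul, Matrix.det_adjugate, det_lineMatrix, det_lineMatrix, N.2]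
    simp; ring
  obtain ⟨y, u, hY⟩ := hf.exists_eq_similitude (pow_ne_zero 2 hp0) hdet (by
    rw [act_mul, act_mul]
    change ((f.restrict L).act N.1).act _ = _
    rw [← hN, restrict, ← act_mul, Matrix.mul_adjugate, det_lineMatrix, act_smul_one])
  rw [hY, det_similitude] at hdet
  obtain ⟨w, rfl⟩ := (onLine_iff L₀ v).1 hv
  have hz : mulPair (f.similitude y u) (mulPair (lineMatrix L₀) w) =
      ((p : ℤ) * (mulPair (lineMatrix L) (mulPair N.1 w)).1,
        (p : ℤ) * (mulPair (lineMatrix L) (mulPair N.1 w)).2) := by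
    rw [← hY, ← mulPair_mul, Matrix.mul_assoc, Matrix.adjugate_mul, det_lineMatrix]
    rw [← mulPair_mul, Matrix.mul_smul, Matrix.mul_one]
    simp [mulPair]; constructor <;> ring
  have hzL : OnLine L (mulPair (lineMatrix L) (mulPair N.1 w)) := (onLine_iff L _).2 ⟨_, rfl⟩
  generalize mulPair (lineMatrix L) (mulPair N.1 w) = z at *
  generalize mulPair (lineMatrix L₀) w = v at *
  simp [mulPair, similitude] at hz
  obtain ⟨hz1, hz2⟩ := hz
  rw [Ne, ZMod.intCast_zmod_eq_zero_iff_dvd] at hv0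
  obtain ⟨U, rfl⟩ : (p : ℤ) ∣ u := by
    refine (hpp.dvd_or_dvd (b := f.eval v.1 v.2) ⟨v.1 * z.2 - v.2 * z.1, ?_⟩).resolve_right hv0
    simp only [eval]
    linear_combination v.1 * hz2 - v.2 * hz1
  obtain ⟨e, rfl⟩ : (p : ℤ) ∣ y := by
    refine (hpp.dvd_or_dvd (b := f.eval v.1 v.2)
      ⟨(f.a * v.1 + f.b * v.2) * (z.1 + f.c * U * v.2) +
        f.c * v.2 * (z.2 - f.a * U * v.1 - f.b * U * v.2), ?_⟩).resolve_right hv0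
    simp only [eval]
    linear_combination (f.a * v.1 + f.b * v.2) * hz1 + f.c * v.2 * hz2
  refine ⟨e, U, ?_, ?_⟩
  · apply mul_left_cancel₀ (pow_ne_zero 2 hp0)
    simp only [orderNorm] at hdet ⊢
    linear_combination hdet
  · convert hzL using 1
    ext <;> refine mul_left_cancel₀ hp0 (Eq.trans ?_ (by assumption)) <;>
      simp only [mulPair, similitude, Matrix.of_apply, Matrix.cons_val_zero, Matrix.cons_val_one,
        Matrix.cons_val'] <;> ring

/-- The units modulo sign act simply transitively on the lines whose restriction lies in a given
primitive class. -/
theorem card_restrict_equiv {f : BQForm ℤ} (hf : f.IsPrimitive) (hD : f.disc < 0)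
    {L₀ : Option (ZMod p)} (hL₀ : (f.restrict L₀).IsPrimitive) :
    (Finset.univ.filter fun L : Option (ZMod p) => f.restrict L ≈ f.restrict L₀).card =
      unitWeight f.disc := by
  obtain ⟨v, hv, hv0⟩ := (isPrimitive_restrict_iff hf L₀).1 hL₀
  obtain ⟨S, hcard, hS, hS', hdist⟩ := f.exists_units hD
  choose ℓ hℓ using fun s : ℤ × ℤ => exists_onLine (p := p) (mulPair (f.similitude s.1 s.2) v)
  have hne : ∀ e u, f.orderNorm e u = 1 →
      ((f.eval (mulPair (f.similitude e u) v).1 (mulPair (f.similitude e u) v).2 : ℤ) : ZMod p) ≠ 0 := by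
    intro e u h
    rw [eval_mulPair, act_similitude, h]
    simpa using hv0
  have himage : (Finset.univ.filter fun L : Option (ZMod p) => f.restrict L ≈ f.restrict L₀) =
      S.image ℓ := by
    ext L
    simp only [Finset.mem_filter, Finset.mem_univ, true_and, Finset.mem_image]
    constructor
    · intro h
      obtain ⟨e, u, h1, hL⟩ := exists_onLine_of_restrict_equiv hf hv hv0 h
      rcases hS' e u h1 with h | h
      · exact ⟨_, h, (hℓ (e, u)).unique hL (not_zero_of_eval (hne e u h1))⟩
      · refine ⟨_, h, OnLine.unique (hℓ (-e, -u)) (hL.of_eq_mul (-1) ?_ ?_)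
          (not_zero_of_eval (hne _ _ (hS _ h)))⟩ <;> simp [mulPair, similitude] <;> ring
    · rintro ⟨s, hs, rfl⟩
      exact restrict_equiv_of_onLine hv hv0 (hS s hs) (hℓ s)
  rw [himage, Finset.card_image_of_injOn, hcard]
  intro s hs t ht hst
  by_contra hne'
  have hw := (onLine_iff_wedge (hℓ s) (not_zero_of_eval (hne _ _ (hS s hs))) _).1 (hst ▸ hℓ t)
  have hunit := hdist s hs t ht hne'
  have h0 : (((s.1 * t.2 - s.2 * t.1) * f.eval v.1 v.2 : ℤ) : ZMod p) = 0 := by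
    simp [mulPair, similitude] at hw
    simp only [eval]
    push_cast
    linear_combination hw
  rw [Int.cast_mul] at h0
  exact mul_ne_zero (hunit.map (Int.castRingHom (ZMod p))).ne_zero hv0 h0

end Fibers

/-! ### Counting vectors and lines -/

theorem IsPosDef.finite_eval_eq {f : BQForm ℤ} (hf : f.IsPosDef) (n : ℤ) :
    {v : ℤ × ℤ | f.eval v.1 v.2 = n}.Finite := by
  obtain ⟨ha, hD⟩ := hf
  simp only [disc] at hD
  have hc : 0 < f.c := by nlinarith [sq_nonneg f.b]
  set K := max (4 * f.a * n) (4 * f.c * n)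
  refine ((Set.finite_Icc (-K) K).prod (Set.finite_Icc (-K) K)).subset ?_
  rintro ⟨x, y⟩ h
  simp only [Set.mem_ofPred_eq, eval] at h
  have hsq : ∀ z : ℤ, z ^ 2 ≤ K → z ∈ Set.Icc (-K) K := by
    intro z hz
    constructor <;> nlinarith
  refine ⟨hsq x ?_, hsq y ?_⟩
  · refine le_trans ?_ (le_max_right _ _)
    nlinarith [sq_nonneg (2 * f.c * y + f.b * x), sq_nonneg x]
  · refine le_trans ?_ (le_max_left _ _)
    nlinarith [sq_nonneg (2 * f.a * x + f.b * y), sq_nonneg y]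

section Counting

variable {p : ℕ} [hp : Fact p.Prime]

/-- The forms in `buellForms` are the restrictions of `f` to the sublattices of index `p`. -/
theorem mem_buellForms {f g : BQForm ℤ} :
    g ∈ buellForms p f ↔ ∃ L : Option (ZMod p), f.restrict L = g := by
  have h1 : f.restrict (none : Option (ZMod p)) = ⟨f.a, f.b * p, f.c * p ^ 2⟩ := by
    ext <;> simp [restrict, act, eval, lineMatrix]
  have h2 : ∀ h : ZMod p, f.restrict (some h) =
      ⟨f.a * p ^ 2, p * f.b + 2 * f.a * h.val * p, f.a * h.val ^ 2 + f.b * h.val + f.c⟩ := by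
    intro h
    ext <;> simp [restrict, act, eval, lineMatrix, -ZMod.natCast_val]
    ring
  simp only [buellForms, Finset.mem_insert, Finset.mem_image, Finset.mem_range, Option.exists, h1, h2,
    eq_comm (a := g)]
  refine or_congr_right ⟨?_, ?_⟩
  · rintro ⟨h, hh, rfl⟩
    exact ⟨h, by rw [ZMod.val_natCast_of_lt hh]⟩
  · rintro ⟨h, rfl⟩
    exact ⟨h.val, h.val_lt, rfl⟩

/-- The lines whose restriction is primitive with class in `G`. -/
noncomputable def genusLines (G : Set FormClass) (p : ℕ) [Fact p.Prime] (f : BQForm ℤ) :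
    Finset (Option (ZMod p)) :=
  Finset.univ.filter fun L => (f.restrict L).IsPrimitive ∧ (⟦f.restrict L⟧ : FormClass) ∈ G

theorem mem_genusLines {G : Set FormClass} {f : BQForm ℤ} {L : Option (ZMod p)} :
    L ∈ genusLines G p f ↔ (f.restrict L).IsPrimitive ∧ (⟦f.restrict L⟧ : FormClass) ∈ G := by
  simp [genusLines]

theorem buellPsi_eq_image (G : Set FormClass) (f : BQForm ℤ) :
    buellPsi G p f = (genusLines G p f).image fun L => (⟦f.restrict L⟧ : FormClass) := by
  ext C
  simp only [buellPsi, Finset.mem_filter, Finset.mem_image, mem_buellForms, mem_genusLines]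
  constructor
  · rintro ⟨⟨_, ⟨⟨L, rfl⟩, hg⟩, rfl⟩, hG⟩
    exact ⟨L, ⟨hg, hG⟩, rfl⟩
  · rintro ⟨L, ⟨hL, hG⟩, rfl⟩
    exact ⟨⟨_, ⟨⟨L, rfl⟩, hL⟩, rfl⟩, hG⟩

theorem card_genusLines_fiber {f : BQForm ℤ} (hf : f.IsPrimitive) (hD : f.disc < 0)
    {G : Set FormClass} {C : FormClass} (hC : C ∈ buellPsi G p f) :
    ((genusLines G p f).filter fun L => (⟦f.restrict L⟧ : FormClass) = C).card =
      unitWeight f.disc := by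
  rw [buellPsi_eq_image, Finset.mem_image] at hC
  obtain ⟨L₀, hL₀, rfl⟩ := hC
  rw [mem_genusLines] at hL₀
  rw [← card_restrict_equiv hf hD hL₀.1]
  congr 1
  ext L
  simp only [Finset.mem_filter, mem_genusLines, Finset.mem_univ, true_and]
  constructor
  · rintro ⟨_, h⟩
    exact Quotient.exact h
  · intro h
    have h' : (⟦f.restrict L⟧ : FormClass) = ⟦f.restrict L₀⟧ := Quotient.sound h
    refine ⟨⟨?_, h' ▸ hL₀.2⟩, h'⟩
    obtain ⟨M, hM⟩ := Setoid.symm h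
    rw [hM]
    exact hL₀.1.act M

theorem sum_genusLines {f : BQForm ℤ} (hf : f.IsPrimitive) (hD : f.disc < 0) (G : Set FormClass)
    (F : FormClass → ℕ) :
    ∑ L ∈ genusLines G p f, F ⟦f.restrict L⟧ = unitWeight f.disc * ∑ C ∈ buellPsi G p f, F C := by
  rw [← Finset.sum_fiberwise_of_maps_to (t := buellPsi G p f)
    (g := fun L => (⟦f.restrict L⟧ : FormClass)), Finset.mul_sum]
  · refine Finset.sum_congr rfl fun C hC => ?_
    rw [← card_genusLines_fiber hf hD hC, ← smul_eq_mul, ← Finset.sum_const]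
    refine Finset.sum_congr rfl fun L hL => ?_
    rw [(Finset.mem_filter.1 hL).2]
  · intro L hL
    rw [buellPsi_eq_image]
    exact Finset.mem_image_of_mem _ hL

theorem card_genusLines {f : BQForm ℤ} (hf : f.IsPrimitive) (hD : f.disc < 0) (G : Set FormClass) :
    (genusLines G p f).card = unitWeight f.disc * (buellPsi G p f).card := by
  simpa using sum_genusLines (p := p) hf hD G fun _ => 1

/-- Double counting of pairs `v ∈ L`, when every vector nonzero modulo `p` with value `n` lies on
exactly `χ` lines of `genusLines`: vectors in `pℤ²` lie on all lines. -/
theorem sum_repCount_genusLines {f : BQForm ℤ} (hpos : f.IsPosDef)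
    {G : Set FormClass} {n : ℕ} (χ : ℕ)
    (hχ : ∀ v : ℤ × ℤ, f.eval v.1 v.2 = n → ¬ ((v.1 : ZMod p) = 0 ∧ (v.2 : ZMod p) = 0) →
      ((genusLines G p f).filter fun L => OnLine L v).card = χ) :
    ∑ L ∈ genusLines G p f, (f.restrict L).repCount n =
      (genusLines G p f).card *
        {v : ℤ × ℤ | f.eval v.1 v.2 = n ∧ ((v.1 : ZMod p) = 0 ∧ (v.2 : ZMod p) = 0)}.ncard +
      χ * {v : ℤ × ℤ | f.eval v.1 v.2 = n ∧ ¬ ((v.1 : ZMod p) = 0 ∧ (v.2 : ZMod p) = 0)}.ncard := by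
  have hfin := hpos.finite_eval_eq n
  set V := hfin.toFinset with hV
  have hmem : ∀ v, v ∈ V ↔ f.eval v.1 v.2 = n := fun v => by simp [hV]
  have hcard : ∀ (P : ℤ × ℤ → Prop) [DecidablePred P], {v : ℤ × ℤ | f.eval v.1 v.2 = n ∧ P v}.ncard =
      (V.filter P).card := by
    intro P _
    rw [← Set.ncard_coe_finset]
    congr 1
    ext v
    simp [hmem]
  have e1 : ∀ L : Option (ZMod p), (f.restrict L).repCount n = (V.filter fun v => OnLine L v).card := by
    intro L
    rw [repCount_restrict, ← hcard]
    congr 1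
    ext v
    exact and_comm
  simp only [e1]
  have e2 := Finset.sum_card_bipartiteAbove_eq_sum_card_bipartiteBelow (s := genusLines G p f)
    (t := V) fun L v => OnLine L v
  simp only [Finset.bipartiteAbove, Finset.bipartiteBelow] at e2
  rw [e2, hcard, hcard,
    ← Finset.sum_filter_add_sum_filter_not V
      (fun v => (v.1 : ZMod p) = 0 ∧ (v.2 : ZMod p) = 0)]
  congr 1
  · rw [mul_comm, ← smul_eq_mul, ← Finset.sum_const]
    refine Finset.sum_congr rfl fun v hv => ?_
    have h0 := (Finset.mem_filter.1 hv).2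
    rw [Finset.filter_true_of_mem]
    exact fun L _ => onLine_of_eq_zero L h0.1 h0.2
  · rw [mul_comm, ← smul_eq_mul, ← Finset.sum_const]
    refine Finset.sum_congr rfl fun v hv => ?_
    obtain ⟨h1, h2⟩ := Finset.mem_filter.1 hv
    exact hχ v ((hmem v).1 h1) h2

theorem ncard_eval_eq_of_zero (f : BQForm ℤ) (n : ℕ) :
    ({v : ℤ × ℤ | f.eval v.1 v.2 = n ∧ ((v.1 : ZMod p) = 0 ∧ (v.2 : ZMod p) = 0)}.ncard : ℚ) =
      PowerSeries.coeff n (PowerSeries.expand (p ^ 2) (pow_ne_zero 2 hp.out.ne_zero) f.theta) := by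
  have hp0 : (p : ℤ) ≠ 0 := by exact_mod_cast hp.out.ne_zero
  have hset : {v : ℤ × ℤ | f.eval v.1 v.2 = n ∧ ((v.1 : ZMod p) = 0 ∧ (v.2 : ZMod p) = 0)} =
      (fun w : ℤ × ℤ => ((p : ℤ) * w.1, (p : ℤ) * w.2)) ''
        {w | (p : ℤ) ^ 2 * f.eval w.1 w.2 = n} := by
    have he : ∀ x y : ℤ, f.eval (p * x) (p * y) = (p : ℤ) ^ 2 * f.eval x y := by
      intro x y; simp only [eval]; ring
    ext ⟨x, y⟩
    simp only [Set.mem_ofPred_eq, Set.mem_image, ZMod.intCast_zmod_eq_zero_iff_dvd, Prod.mk.injEq]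
    constructor
    · rintro ⟨h, ⟨x, rfl⟩, ⟨y, rfl⟩⟩
      exact ⟨(x, y), by rw [← h, he], rfl, rfl⟩
    · rintro ⟨w, h, rfl, rfl⟩
      exact ⟨by rw [he, h], ⟨_, rfl⟩, ⟨_, rfl⟩⟩
  have hinj : Function.Injective (fun w : ℤ × ℤ => ((p : ℤ) * w.1, (p : ℤ) * w.2)) := by
    rintro ⟨x, y⟩ ⟨x', y'⟩ h
    simpa [hp0, hp.out.ne_zero] using h
  rw [hset, Set.ncard_image_of_injective _ hinj]
  by_cases hn : p ^ 2 ∣ n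
  · obtain ⟨m, rfl⟩ := hn
    rw [PowerSeries.coeff_expand_mul, theta, PowerSeries.coeff_mk, repCount]
    congr 2
    ext w
    simp only [Set.mem_ofPred_eq]
    push_cast
    exact mul_right_inj' (pow_ne_zero 2 hp0)
  · rw [PowerSeries.coeff_expand_of_not_dvd _ _ _ hn]
    rw [Set.eq_empty_of_forall_notMem (s := {w : ℤ × ℤ | (p : ℤ) ^ 2 * f.eval w.1 w.2 = n})]
    · simp
    · intro w hw
      exact hn (by exact_mod_cast Dvd.intro _ hw)

end Counting

/-! ### The theta identity -/

section Final

variable {p : ℕ} [hp : Fact p.Prime]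

theorem card_filter_onLine {G : Set FormClass} {f : BQForm ℤ} {L : Option (ZMod p)} {v : ℤ × ℤ}
    (hv : OnLine L v) (h0 : ¬ ((v.1 : ZMod p) = 0 ∧ (v.2 : ZMod p) = 0)) :
    ((genusLines G p f).filter fun L => OnLine L v).card = if L ∈ genusLines G p f then 1 else 0 := by
  have : ((genusLines G p f).filter fun L => OnLine L v) =
      (genusLines G p f).filter fun L' => L' = L :=
    Finset.filter_congr fun L' _ => ⟨fun h => h.unique hv h0, fun h => h ▸ hv⟩
  rw [this, Finset.filter_eq']
  split_ifs <;> simp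

theorem mem_genusLines_iff {G : Set FormClass} {f : BQForm ℤ} (hf : f.IsPrimitive)
    (hpos : f.IsPosDef) (hG : IsGenus (f.disc * (p : ℤ) ^ 2) G) {L₁ L : Option (ZMod p)}
    (hL₁ : L₁ ∈ genusLines G p f) {v : ℤ × ℤ} (hv : OnLine L v)
    (hv0 : ((f.eval v.1 v.2 : ℤ) : ZMod p) ≠ 0) :
    L ∈ genusLines G p f ↔
      SameGenus (f.disc * (p : ℤ) ^ 2) (f.restrict L₁) (f.restrict L) := by
  obtain ⟨g₀, -, -, -, rfl⟩ := hG
  simp only [mem_genusLines] at hL₁ ⊢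
  have hprim := (isPrimitive_restrict_iff hf L).2 ⟨v, hv, hv0⟩
  obtain ⟨-, g₁, -, -, -, hg₁, e₁⟩ := hL₁
  have h₁ := hg₁.trans (sameGenus_of_equiv _ (Quotient.exact e₁))
  constructor
  · rintro ⟨-, g, -, -, -, hg, e⟩
    exact h₁.symm.trans (hg.trans (sameGenus_of_equiv _ (Quotient.exact e)))
  · intro h
    exact ⟨hprim, _, hprim, hpos.restrict L, disc_restrict f L, h₁.trans h, rfl⟩

/-- The theta identity, with the coefficients of the last series given by a condition `P n` that
describes which lines through vectors of value `n` belong to `genusLines`. -/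
theorem theta_sum_eq {f : BQForm ℤ} (hf : f.IsPrimitive) (hpos : f.IsPosDef) {G : Set FormClass}
    {P : ℕ → Prop} [DecidablePred P] (hP : ∀ n, P n → ¬ p ∣ n)
    (hL : ∀ (L : Option (ZMod p)) (v : ℤ × ℤ) (n : ℕ), OnLine L v →
      ¬ ((v.1 : ZMod p) = 0 ∧ (v.2 : ZMod p) = 0) → f.eval v.1 v.2 = n →
      (L ∈ genusLines G p f ↔ P n)) :
    (unitWeight f.disc : ℚ) • ∑ C ∈ buellPsi G p f, C.theta =
      ((unitWeight f.disc : ℚ) * ((buellPsi G p f).card : ℚ)) •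
          PowerSeries.expand (p ^ 2) (pow_ne_zero 2 hp.out.ne_zero) f.theta +
        PowerSeries.mk fun n => if P n then PowerSeries.coeff n f.theta else 0 := by
  ext n
  let F : FormClass → ℕ := Quotient.lift (fun g => g.repCount n) (by
    rintro f g ⟨M, rfl⟩; exact (repCount_act f M n).symm)
  have hF : ∀ C : FormClass, PowerSeries.coeff n C.theta = F C := by
    intro C
    induction C using Quotient.inductionOn with
    | h g => simp [FormClass.theta, BQForm.theta, F]
  have h1 := sum_genusLines (p := p) hf hpos.2 G F
  rw [show (fun L : Option (ZMod p) => F ⟦f.restrict L⟧) = fun L => (f.restrict L).repCount n from rfl,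
    sum_repCount_genusLines hpos (if P n then 1 else 0) (by
      intro v hv h0
      obtain ⟨L, hL'⟩ := exists_onLine (p := p) v
      rw [card_filter_onLine hL' h0]
      simp only [hL L v n hL' h0 hv]), card_genusLines hf hpos.2] at h1
  have h2 := congrArg (Nat.cast (R := ℚ)) h1
  push_cast at h2
  rw [ncard_eval_eq_of_zero] at h2
  rw [map_add, PowerSeries.coeff_smul, PowerSeries.coeff_smul, map_sum, PowerSeries.coeff_mk,
    smul_eq_mul, smul_eq_mul, Finset.sum_congr rfl fun C _ => hF C, ← h2]
  congr 1
  split_ifs with h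
  · rw [one_mul, theta, PowerSeries.coeff_mk, repCount]
    congr 2
    ext v
    simp only [Set.mem_ofPred_eq, and_iff_left_iff_imp]
    intro hv
    refine not_zero_of_eval (f := f) ?_
    rw [hv, Ne, ZMod.intCast_zmod_eq_zero_iff_dvd]
    exact_mod_cast hP n h
  · rw [zero_mul]

theorem exists_genusLine_of_represents {G : Set FormClass} {f : BQForm ℤ} {r : ℤ}
    (hrep : ∃ C ∈ buellPsi G p f, C.Represents r) :
    ∃ L ∈ genusLines G p f, ∃ v, OnLine L v ∧ f.eval v.1 v.2 = r := by
  obtain ⟨C, hC, g, hg, x, y, hxy⟩ := hrep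
  rw [buellPsi_eq_image, Finset.mem_image] at hC
  obtain ⟨L, hL, rfl⟩ := hC
  obtain ⟨M, rfl⟩ := Quotient.exact hg.symm
  refine ⟨L, hL, (exists_eval_restrict f L r).1 ⟨mulPair M.1 (x, y), ?_⟩⟩
  rw [eval_mulPair, hxy]

theorem eval_ne_zero_of_mem_genusLines {G : Set FormClass} {f : BQForm ℤ} (hf : f.IsPrimitive)
    {L : Option (ZMod p)} (hL : L ∈ genusLines G p f) {v : ℤ × ℤ} (hv : OnLine L v)
    (h0 : ¬ ((v.1 : ZMod p) = 0 ∧ (v.2 : ZMod p) = 0)) : ((f.eval v.1 v.2 : ℤ) : ZMod p) ≠ 0 := by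
  obtain ⟨w, hw, hw0⟩ := (isPrimitive_restrict_iff hf L).1 (mem_genusLines.1 hL).1
  obtain ⟨k, hk⟩ := hv.exists_eval_eq f hw h0
  intro h
  rw [h, mul_zero] at hk
  exact hw0 hk

/-- Only the index `i = n % p` contributes to the coefficient of `q ^ n`. -/
theorem legendre_sum_eq {r : ℤ} (hr : (r : ZMod p) ≠ 0) (φ : PowerSeries ℚ) :
    ∑ i ∈ Finset.Icc 1 (p - 1),
        ((1 : ℚ) / 2 * ((legendreSym p (r * (i : ℤ)) : ℚ) + 1)) • powerSeriesProj p (i : ℤ) φ =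
      PowerSeries.mk fun n => if ¬ p ∣ n ∧ IsSquare ((r * n : ℤ) : ZMod p) then
        PowerSeries.coeff n φ else 0 := by
  ext n
  simp only [map_sum, PowerSeries.coeff_smul, powerSeriesProj, PowerSeries.coeff_mk, smul_eq_mul,
    mul_ite, mul_zero, Int.natCast_modEq_iff]
  have hpos := hp.out.pos
  by_cases hn : p ∣ n
  · rw [if_neg (by tauto)]
    refine Finset.sum_eq_zero fun i hi => if_neg fun h => ?_
    obtain ⟨h1, h2⟩ := Finset.mem_Icc.1 hi
    have := (h.dvd_iff dvd_rfl).1 hn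
    exact absurd (Nat.le_of_dvd h1 this) (by lia)
  · have hmod : n % p ≠ 0 := fun h => hn (Nat.dvd_of_mod_eq_zero h)
    have hlt := Nat.mod_lt n hpos
    rw [Finset.sum_eq_single (n % p)]
    · rw [if_pos (Nat.mod_modEq n p).symm]
      have hrn : ((r * ((n % p : ℕ) : ℤ) : ℤ) : ZMod p) ≠ 0 := by
        push_cast
        exact mul_ne_zero hr (by rwa [Ne, ZMod.natCast_eq_zero_iff])
      have hiff : IsSquare ((r * n : ℤ) : ZMod p) ↔ legendreSym p (r * ((n % p : ℕ) : ℤ)) = 1 := by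
        rw [legendreSym.eq_one_iff p hrn]
        push_cast
        rfl
      rcases legendreSym.eq_one_or_neg_one p hrn with h | h
      · rw [if_pos ⟨hn, hiff.2 h⟩, h]; norm_num
      · rw [if_neg (fun h' => by rw [hiff.1 h'.2] at h; norm_num at h), h]; norm_num
    · intro i hi hin
      obtain ⟨h1, h2⟩ := Finset.mem_Icc.1 hi
      refine if_neg fun h => hin ?_
      rw [h, Nat.mod_eq_of_lt (by lia)]
    · intro h
      exact absurd (Finset.mem_Icc.2 ⟨by lia, by lia⟩) h

end Final

end BQForm

open BQForm in
theorem theorem5p1 (f : BQForm ℤ) (hprim : f.IsPrimitive) (hpos : f.IsPosDef)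
    (p : ℕ) [hp : Fact p.Prime] (G : Set FormClass) (hG : IsGenus (f.disc * (p : ℤ) ^ 2) G)
    (hne : (buellPsi G p f).Nonempty) (r : ℤ) (hr : IsCoprime r (f.disc * (p : ℤ) ^ 2))
    (hrep : ∃ C ∈ buellPsi G p f, C.Represents r) :
    (p ≠ 2 →
      (unitWeight f.disc : ℚ) • ∑ C ∈ buellPsi G p f, C.theta =
        ((unitWeight f.disc : ℚ) * ((buellPsi G p f).card : ℚ)) •
            PowerSeries.expand (p ^ 2) (pow_ne_zero 2 hp.out.ne_zero) f.theta +
          ∑ i ∈ Finset.Icc 1 (p - 1),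
            ((1 : ℚ) / 2 * ((legendreSym p (r * (i : ℤ)) : ℚ) + 1)) •
              powerSeriesProj p (i : ℤ) f.theta) ∧
    (p = 2 →
      (unitWeight f.disc : ℚ) • ∑ C ∈ buellPsi G p f, C.theta =
        ((unitWeight f.disc : ℚ) * ((buellPsi G p f).card : ℚ)) •
            PowerSeries.expand 4 (by norm_num) f.theta +
          powerSeriesProj (2 ^ (twoExponent f.disc + 1)) r f.theta) := by
  obtain ⟨L₁, hL₁, v₁, hv₁, rfl⟩ := exists_genusLine_of_represents hrep
  have hr0 : ((f.eval v₁.1 v₁.2 : ℤ) : ZMod p) ≠ 0 :=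
    isCoprime_iff_zmod.1 (hr.of_isCoprime_of_dvd_right ⟨f.disc * p, by ring⟩)
  have hD : f.disc ≠ 0 := hpos.2.ne
  constructor
  · intro hp2
    rw [legendre_sum_eq hr0]
    refine theta_sum_eq hprim hpos (fun n h => h.1) fun L v n hv h0 hn => ?_
    have hdvd : ¬ p ∣ n ↔ ((f.eval v.1 v.2 : ℤ) : ZMod p) ≠ 0 := by
      rw [hn, Int.cast_natCast, Ne, ZMod.natCast_eq_zero_iff]
    rw [hdvd, ← hn]
    constructor
    · intro hL
      have hv0 := eval_ne_zero_of_mem_genusLines hprim hL hv h0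
      exact ⟨hv0, ((mem_genusLines_iff hprim hpos hG hL₁ hv hv0).1 hL).isSquare hv₁ hv hr0⟩
    · rintro ⟨hv0, hsq⟩
      exact (mem_genusLines_iff hprim hpos hG hL₁ hv hv0).2
        (sameGenus_of_isSquare hp2 hprim hD hv₁ hv hr0 hv0 hsq)
  · rintro rfl
    have hmod : ∀ {z : ℤ}, z ≡ f.eval v₁.1 v₁.2 [ZMOD ((2 ^ (twoExponent f.disc + 1) : ℕ) : ℤ)] →
        Odd z := by
      intro z h
      rw [odd_iff_intCast_ne_zero, (ZMod.intCast_eq_intCast_iff _ _ 2).2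
        (h.of_dvd (by exact_mod_cast dvd_pow_self 2 (Nat.succ_ne_zero _)))]
      exact hr0
    refine theta_sum_eq (p := 2) hprim hpos (P := fun n : ℕ => (n : ℤ) ≡ f.eval v₁.1 v₁.2
      [ZMOD ((2 ^ (twoExponent f.disc + 1) : ℕ) : ℤ)]) (fun n h => ?_) fun L v n hv h0 hn => ?_
    · have := hmod h
      rwa [← even_iff_two_dvd, Nat.not_even_iff_odd, ← Int.odd_coe_nat]
    · rw [← hn]
      constructor
      · intro hL
        have hv0 := eval_ne_zero_of_mem_genusLines hprim hL hv h0
        have hsg := (mem_genusLines_iff hprim hpos hG hL₁ hv hv0).1 hL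
        exact (hsg.modEq hv₁ hv (odd_iff_intCast_ne_zero.2 hr0) (odd_iff_intCast_ne_zero.2 hv0)).symm
      · intro h
        have hv0 := hmod h
        exact (mem_genusLines_iff hprim hpos hG hL₁ hv (odd_iff_intCast_ne_zero.1 hv0)).2
          (sameGenus_of_modEq hprim hD hv₁ hv (odd_iff_intCast_ne_zero.2 hr0) hv0 h.symm)
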